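/- Let $(\phi_k)_{k\ge1}$ be an orthonormal basis of $L^2[0,1]$ with norm $\|\cdot\|_2$, and write $f_k=\int_0^1 f\phi_k$. In the Gaussian white noise model $dY^n(t)=f(t)\,dt+n^{-1/2}dB(t)$, $t\in[0,1]$, written in sequence form, one observes $Y^n=(Y_k)_{k\ge1}$ with $$Y_k=f_k+n^{-1/2}\epsilon_k,\qquad \epsilon_k\ \text{i.i.d. } \mathcal N(0,1);$$ let $P_f^n$ denote the law of $Y^n$. Set $$K_n=\lfloor n/\log n\rfloor,\qquad \psi(f)=\|f\|_2^2,\qquad \bar\psi=\sum_{k=1}^{K_n}\Big(Y_k^2-\frac1n\Big).$$ Let $\beta>1/4$ and let the true function $f_0\in L^2[0,1]$ belong to the Sobolev class $W_\beta=\{f\in L^2[0,1]:\ \sum_{k\ge1}k^{2\beta}f_k^2<\infty\}$. Let $(\sigma_k)_{k\ge1}$ be a sequence of positive real numbers, not depending on $n$, and let $M>0$ be such that for all sufficiently large $n$ $$\frac{|f_{0,k}|}{\sigma_k}\le M\quad\text{and}\quad \sigma_k\ge\frac1{\sqrt n}\qquad(1\le k\le K_n).$$ Given a probability density $\varphi$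 on $\mathbb R$, let the prior $\Pi=\Pi_n$ on $f$ make the coordinates $f_k$ independent, with $f_k$ having density $\sigma_k^{-1}\varphi(\cdot/\sigma_k)$ for $1\le k\le K_n$, and $f_k=0$ for $k>K_n$. Let $\Pi[\,\cdot\mid Y^n]$ be the posterior distribution given by Bayes' formula. Suppose that one of the following holds: 1. (Gaussian $\varphi$) $\varphi$ is the standard Gaussian density and, as $n\to\infty$, $$\frac1{\sqrt n}\sum_{k=1}^{K_n}\frac{\sigma_k^{-2}}{n}\to0.$$ 2. (Uniform $\varphi$) $\varphi=\frac1{2\mathcal M}\mathbf 1_{[-\mathcal M,\mathcal M]}$ with $\mathcal M>\max(4,16M)$ and, for every $c>0$, as $n\to\infty$, $$\sum_{k=1}^{K_n}\sigma_k e^{-cn\sigma_k^2}\to0.$$ Then, as $n\to\infty$, the posterior distribution of $\sqrt n\big(\psi(f)-\bar\psi-2K_n/n\big)$ given $Y^n$ converges weakly to $\mathcal N(0,4\|f_0\|_2^2)$ in $P_{f_0}^n$-probability; that is, the bounded Lipschitz distance between the two distributions tends to $0$ in $P_{f_0}^n$-probability (with $\mathcal N(0,0)=\delta_0$ when $f_0=0$).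 -/

import Mathlib

open MeasureTheory ProbabilityTheory Filter Topology
open scoped NNReal ENNReal

namespace WhiteNoise

/-- The Hilbert space `L²[0,1]` of real square-integrable functions (Lebesgue measure). -/
abbrev L2 : Type := Lp ℝ 2 ((volume : Measure ℝ).restrict (Set.Icc (0 : ℝ) 1))

/-- `L²[0,1]` carries its Borel σ-algebra. -/
noncomputable instance instMeasurableSpaceL2 : MeasurableSpace L2 := borel L2

instance instBorelSpaceL2 : BorelSpace L2 := ⟨rfl⟩

/-! Sequences are indexed from zero: the index `k : ℕ` stands for the `(k+1)`-st basis element,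
coefficient, observation or scale. An orthonormal basis of `L²[0,1]` is a
`HilbertBasis ℕ ℝ L2`. -/

/-- The coefficient `⟨f, φ_k⟩` of `f` in the orthonormal basis `φ`. -/
noncomputable def coef (φ : HilbertBasis ℕ ℝ L2) (f : L2) (k : ℕ) : ℝ := inner ℝ (φ k) f

/-- The Sobolev class `W_β` with respect to the basis `φ`. -/
def Sobolev (φ : HilbertBasis ℕ ℝ L2) (β : ℝ) : Set L2 :=
  {f | Summable fun k : ℕ => ((k : ℝ) + 1) ^ (2 * β) * coef φ f k ^ 2}

/-- The law `P_f^n` of the observation `Y = (Y_k)` in the Gaussian white noise model: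
`Y_k = f_k + n^{-1/2} ε_k` with `ε_k` i.i.d. standard normal. -/
noncomputable def obsLaw (φ : HilbertBasis ℕ ℝ L2) (n : ℕ) (f : L2) : Measure (ℕ → ℝ) :=
  Measure.infinitePi fun k => gaussianReal (coef φ f k) (1 / (n : ℝ≥0))

/-- The log-likelihood `log (dP_f^n / dP_0^n)(y) = n ∑_k f_k y_k - n ‖f‖² / 2`, the dominating
measure being the law `P_0^n` of pure noise. For every `f ∈ L²[0,1]` the partial sums converge for
almost every `y`; for `f` with finitely many nonzero coefficients they are eventually constant. -/
noncomputable def logLik (φ : HilbertBasis ℕ ℝ L2) (n : ℕ) (f : L2) (y : ℕ → ℝ) : ℝ :=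
  n * limUnder atTop (fun N : ℕ => ∑ k ∈ Finset.range N, coef φ f k * y k) - n * ‖f‖ ^ 2 / 2

/-- The likelihood `p_f^n(y)`. -/
noncomputable def lik (φ : HilbertBasis ℕ ℝ L2) (n : ℕ) (f : L2) (y : ℕ → ℝ) : ℝ≥0∞ :=
  ENNReal.ofReal (Real.exp (logLik φ n f y))

/-- The posterior distribution given by Bayes' formula,
`Π[B | y] = ∫_B p_f^n(y) dΠ(f) / ∫ p_f^n(y) dΠ(f)`. -/
noncomputable def posterior (φ : HilbertBasis ℕ ℝ L2) (n : ℕ) (prior : Measure L2) (y : ℕ → ℝ) :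
    Measure L2 :=
  (∫⁻ f, lik φ n f y ∂prior)⁻¹ • prior.withDensity fun f => lik φ n f y

/-- The truncation level `K_n = ⌊n / log n⌋`. -/
noncomputable def truncLevel (n : ℕ) : ℕ := ⌊(n : ℝ) / Real.log n⌋₊

/-- The probability law on `ℝ` with density `x ↦ dens (x / s) / s`. -/
noncomputable def coordLaw (dens : ℝ → ℝ) (s : ℝ) : Measure ℝ :=
  volume.withDensity fun x => ENNReal.ofReal (1 / s * dens (x / s))

/-- The truncated product prior: `f_k`, for the first `K_n` indices, are independent with density
`dens (· / σ_k) / σ_k`, and all the other coefficients vanish. -/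
noncomputable def prior (φ : HilbertBasis ℕ ℝ L2) (dens : ℝ → ℝ) (σ : ℕ → ℝ) (n : ℕ) :
    Measure L2 :=
  (Measure.pi fun k : Fin (truncLevel n) => coordLaw dens (σ k)).map
    fun θ => ∑ k : Fin (truncLevel n), θ k • φ k

/-- The standard Gaussian density. -/
noncomputable def gaussDens : ℝ → ℝ := gaussianPDFReal 0 1

/-- The uniform density on `[-R, R]`. -/
noncomputable def unifDens (R : ℝ) : ℝ → ℝ :=
  Set.indicator (Set.Icc (-R) R) fun _ => 1 / (2 * R)

/-- The estimator `ψ̄_n = ∑_{k ≤ K_n} (Y_k² - 1/n)` of `‖f‖²`. -/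
noncomputable def psiBar (n : ℕ) (y : ℕ → ℝ) : ℝ :=
  ∑ k ∈ Finset.range (truncLevel n), (y k ^ 2 - 1 / (n : ℝ))

/-- The bounded Lipschitz distance between probability measures on `ℝ`: the supremum of
`|∫ F dμ - ∫ F dν|` over functions `F` with `‖F‖_∞ + Lip(F) ≤ 1`. -/
noncomputable def blDist (μ ν : Measure ℝ) : ℝ :=
  sSup {r : ℝ | ∃ (F : ℝ → ℝ) (A L : ℝ≥0), A + L ≤ 1 ∧ (∀ x, |F x| ≤ A) ∧ LipschitzWith L F ∧
    r = |(∫ x, F x ∂μ) - ∫ x, F x ∂ν|}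

/-- The posterior distribution of `√n (‖f‖² - ψ̄_n - 2 K_n / n)`, for the truncated product prior
built from `dens` and `σ`, converges weakly to `N(0, 4 ‖f₀‖²)` in `P_{f₀}^n`-probability: the
bounded Lipschitz distance between the two tends to zero in probability. -/
def BvM (φ : HilbertBasis ℕ ℝ L2) (dens : ℝ → ℝ) (σ : ℕ → ℝ) (f₀ : L2) : Prop :=
  ∀ δ : ℝ, 0 < δ → Tendsto (fun n : ℕ => obsLaw φ n f₀ {y | δ < blDist
    ((posterior φ n (prior φ dens σ n) y).map fun f =>
      √(n : ℝ) * (‖f‖ ^ 2 - psiBar n y - 2 * (truncLevel n : ℝ) / (n : ℝ)))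
    (gaussianReal 0 (4 * ‖f₀‖₊ ^ 2))}) atTop (𝓝 0)

end WhiteNoise

/-!
Under the prior and the likelihood the coordinates `f_k`, `k ≤ K_n`, are independent, so the
posterior is the law of a random function with independent coefficients (`posterior_prior_eq`).
Were the prior flat, the posterior of `f_k` would be `N(Y_k, 1/n)`, the law of `Y_k + ξ_k / √n` with
`ξ_k` standard normal, and `√n (∑ f_k² - ∑ Y_k² - K_n / n)` would equal
`2 ∑ Y_k ξ_k + n^{-1/2} ∑ (ξ_k² - 1)`. The first term has law `N(0, 4 ∑ Y_k²)`, and `∑_{k ≤ K_n} Y_k²`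
tends to `‖f₀‖²` in probability; the second has variance of order `K_n / n`, which tends to zero. Both
facts use only that `K_n → ∞` and `K_n / n → 0`.

The actual posterior is compared with the flat one by a coupling in each coordinate
(`CoordCoupling`). As the bounded Lipschitz distance is at most the mean distance in any coupling, it
suffices that the coupling errors `E |f_k² - (Y_k + ξ_k / √n)²|` have an expected sum of order
`o(1 / √n)` (`blDist_pi_le`, `bvM_of_coordCoupling`).

* For the Gaussian prior the posterior is `N(n v Y_k, v)`, `v = (n + σ_k⁻²)⁻¹`. The linear coupling
  has error of order `(σ_k⁻² / n) (Y_k² + 1 / n)`. The noise part is small by the assumption on `σ`, and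
  the signal part `n^{-1/2} ∑ σ_k⁻² f_{0,k}²` by dominated convergence: as `σ` is a fixed sequence with
  `σ_k ≥ 1 / √n` for `k ≤ K_n`, one has `σ_k⁻² = O(k^{1 + ε})`, and `β > 1 / 4` provides the dominating
  series `∑ k^{2 β} f_{0,k}²` (`tendsto_weighted_coef_sum`).
* For the uniform prior the posterior is `N(Y_k, 1/n)` conditioned on `[-R σ_k, R σ_k]`. A draw outside
  the interval is replaced by an independent draw from the conditional law, so that the error is at
  most the second moment of `N(Y_k, 1/n)` outside the interval. As `|f_{0,k}| ≤ R σ_k / 16`, its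
  expectation is of order `n⁻¹ exp (-c n σ_k²)`, hence at most `n^{-1/2} σ_k exp (-c n σ_k²)`
  (`integral_unifError_le`). Total variation would be too crude here: the sum of the probabilities of
  leaving the intervals need not tend to zero, only its effect on the squared norm does.
-/

namespace WhiteNoise

/-! ### Densities and product measures -/

lemma pi_withDensity_prod {ι : Type*} [Fintype ι] {Ω : ι → Type*} [∀ i, MeasurableSpace (Ω i)]
    (μ : ∀ i, Measure (Ω i)) [∀ i, IsProbabilityMeasure (μ i)] {f : ∀ i, Ω i → ℝ≥0∞}
    (hf : ∀ i, Measurable (f i)) [∀ i, SigmaFinite ((μ i).withDensity (f i))] :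
    (Measure.pi μ).withDensity (fun x => ∏ i, f i (x i)) =
      Measure.pi fun i => (μ i).withDensity (f i) := by
  classical
  refine (Measure.pi_eq fun s hs => ?_).symm
  rw [withDensity_apply _ (MeasurableSet.univ_pi hs), ← lintegral_indicator (.univ_pi hs)]
  have h1 : (Set.univ.pi s).indicator (fun x : ∀ i, Ω i => ∏ i, f i (x i)) =
      fun x => ∏ i, (s i).indicator (f i) (x i) := by
    funext x
    by_cases hx : x ∈ Set.univ.pi s
    · rw [Set.indicator_of_mem hx]
      exact Finset.prod_congr rfl fun i _ => (Set.indicator_of_mem (hx i trivial) _).symm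
    · rw [Set.indicator_of_notMem hx]
      simp only [Set.mem_univ_pi, not_forall] at hx
      obtain ⟨i, hi⟩ := hx
      exact (Finset.prod_eq_zero (Finset.mem_univ i) (Set.indicator_of_notMem hi _)).symm
  have hm : ∀ i, Measurable ((s i).indicator (f i)) := fun i => (hf i).indicator (hs i)
  rw [h1, lintegral_prod_eq_prod_lintegral_of_indepFun Finset.univ
    (fun i (x : ∀ i, Ω i) => (s i).indicator (f i) (x i))
    (iIndepFun_pi fun i => (hm i).aemeasurable) fun i => (hm i).comp (measurable_pi_apply i)]
  refine Finset.prod_congr rfl fun i _ => ?_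
  rw [withDensity_apply _ (hs i), ← lintegral_indicator (hs i)]
  exact (measurePreserving_eval μ i).lintegral_comp (hm i)

lemma pi_smul_measure {ι : Type*} [Fintype ι] {Ω : ι → Type*} [∀ i, MeasurableSpace (Ω i)]
    (μ : ∀ i, Measure (Ω i)) [∀ i, IsProbabilityMeasure (μ i)] (c : ι → ℝ≥0∞)
    (hc : ∀ i, c i ≠ ∞) :
    Measure.pi (fun i => c i • μ i) = (∏ i, c i) • Measure.pi μ := by
  have : ∀ i, IsFiniteMeasure (c i • μ i) := fun i => Measure.smul_finite _ (hc i)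
  refine Measure.pi_eq fun s hs => ?_
  simp [Measure.pi_pi, Finset.prod_mul_distrib]

lemma inv_univ_smul_smul {Ω : Type*} [MeasurableSpace Ω] (P : Measure Ω) [IsProbabilityMeasure P]
    {c : ℝ≥0∞} (h0 : c ≠ 0) (hc : c ≠ ∞) : ((c • P) Set.univ)⁻¹ • (c • P) = P := by
  simp [smul_smul, ENNReal.inv_mul_cancel h0 hc]

lemma withDensity_ofReal_mul (f g h : ℝ → ℝ) (C : ℝ) (hf : Measurable f) (hg : Measurable g)
    (hh : Measurable h) (hf0 : ∀ x, 0 ≤ f x) (hC : 0 ≤ C) (hfg : ∀ x, f x * g x = C * h x)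
    {μ : Measure ℝ} :
    (μ.withDensity fun x => ENNReal.ofReal (f x)).withDensity (fun x => ENNReal.ofReal (g x)) =
      ENNReal.ofReal C • μ.withDensity fun x => ENNReal.ofReal (h x) := by
  rw [← withDensity_mul _ (by fun_prop) (by fun_prop), ← withDensity_smul _ (by fun_prop)]
  congr 1
  funext x
  simp only [Pi.mul_apply, Pi.smul_apply, smul_eq_mul]
  rw [← ENNReal.ofReal_mul (hf0 x), hfg, ENNReal.ofReal_mul hC]

/-! ### The posterior in coordinates -/

/-- The likelihood of the single observation `y` at the coefficient value `x`, relative to pure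
noise. -/
noncomputable def coordLik (n : ℕ) (y x : ℝ) : ℝ≥0∞ :=
  ENNReal.ofReal (Real.exp (n * (x * y) - n * x ^ 2 / 2))

lemma measurable_coordLik (n : ℕ) (y : ℝ) : Measurable (coordLik n y) := by
  unfold coordLik
  fun_prop

/-- The function with coefficients `θ`, completed by zeros. -/
noncomputable def synth (φ : HilbertBasis ℕ ℝ L2) (K : ℕ) (θ : Fin K → ℝ) : L2 :=
  ∑ k : Fin K, θ k • φ k

lemma coef_synth (φ : HilbertBasis ℕ ℝ L2) (K : ℕ) (θ : Fin K → ℝ) (j : ℕ) :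
    coef φ (synth φ K θ) j = if h : j < K then θ ⟨j, h⟩ else 0 := by
  have ho := orthonormal_iff_ite.mp φ.orthonormal
  simp only [coef, synth, inner_sum, inner_smul_right, ho]
  split_ifs with h
  · rw [Finset.sum_eq_single ⟨j, h⟩]
    · simp
    · intro b _ hb
      rw [if_neg fun e => hb (Fin.ext e.symm), mul_zero]
    · simp
  · exact Finset.sum_eq_zero fun b _ => by rw [if_neg (by have := b.2; omega), mul_zero]

lemma norm_sq_synth (φ : HilbertBasis ℕ ℝ L2) (K : ℕ) (θ : Fin K → ℝ) :
    ‖synth φ K θ‖ ^ 2 = ∑ k, θ k ^ 2 := by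
  have h : inner ℝ (synth φ K θ) (synth φ K θ) = ∑ k : Fin K, θ k * coef φ (synth φ K θ) k := by
    conv_lhs => enter [2]; rw [synth]
    simp [sum_inner, inner_smul_left, coef]
  rw [← real_inner_self_eq_norm_sq, h]
  refine Finset.sum_congr rfl fun k _ => ?_
  rw [coef_synth, dif_pos k.2, sq]

/-- Being an embedding, `synth` transports integrals of arbitrary functions, so that the
measurability of the likelihood in `f` is not needed. -/
lemma measurableEmbedding_synth (φ : HilbertBasis ℕ ℝ L2) (K : ℕ) :
    MeasurableEmbedding (synth φ K) := by
  let T : (Fin K → ℝ) →ₗ[ℝ] L2 :=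
    { toFun := synth φ K
      map_add' := fun a b => by simp [synth, add_smul, Finset.sum_add_distrib]
      map_smul' := fun a b => by simp [synth, Finset.smul_sum, smul_smul] }
  have hinj : LinearMap.ker T = ⊥ := by
    rw [LinearMap.ker_eq_bot']
    intro θ hθ
    have h := norm_sq_synth φ K θ
    rw [show synth φ K θ = 0 from hθ] at h
    funext k
    have h2 := (Finset.sum_eq_zero_iff_of_nonneg fun k _ => sq_nonneg (θ k)).mp
      (h.symm.trans (by simp)) k (Finset.mem_univ k)
    exact pow_eq_zero_iff (two_ne_zero) |>.mp h2
  exact (LinearMap.isClosedEmbedding_of_injective hinj).measurableEmbedding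

lemma lik_synth (φ : HilbertBasis ℕ ℝ L2) (n K : ℕ) (y : ℕ → ℝ) (θ : Fin K → ℝ) :
    lik φ n (synth φ K θ) y = ∏ k : Fin K, coordLik n (y k) (θ k) := by
  have hlim : limUnder atTop
      (fun N : ℕ => ∑ k ∈ Finset.range N, coef φ (synth φ K θ) k * y k) =
        ∑ k : Fin K, θ k * y k := by
    refine Tendsto.limUnder_eq (tendsto_const_nhds.congr' ?_)
    filter_upwards [eventually_ge_atTop K] with N hN
    rw [← Finset.sum_subset (Finset.range_subset_range.mpr hN), Finset.sum_range]
    · exact Finset.sum_congr rfl fun k _ => by rw [coef_synth, dif_pos k.2]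
    · intro k _ hk
      rw [coef_synth, dif_neg (by simpa using hk), zero_mul]
  rw [lik, logLik, hlim, norm_sq_synth]
  simp only [coordLik]
  rw [← ENNReal.ofReal_prod_of_nonneg fun _ _ => (Real.exp_pos _).le, ← Real.exp_sum]
  congr 2
  rw [Finset.sum_sub_distrib, Finset.mul_sum, ← Finset.sum_div, Finset.mul_sum]

/-- The posterior is the law of a function with independent coefficients, as soon as each
coordinate prior tilted by the likelihood of its observation is a multiple of a probability law. -/
lemma posterior_prior_eq (φ : HilbertBasis ℕ ℝ L2) (dens : ℝ → ℝ) (σ : ℕ → ℝ) (n : ℕ) (y : ℕ → ℝ)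
    (hprob : ∀ k, IsProbabilityMeasure (coordLaw dens (σ k)))
    (P : Fin (truncLevel n) → Measure ℝ) [∀ k, IsProbabilityMeasure (P k)]
    (c : Fin (truncLevel n) → ℝ≥0∞) (hc0 : ∀ k, c k ≠ 0) (hc : ∀ k, c k ≠ ∞)
    (hP : ∀ k : Fin (truncLevel n), (coordLaw dens (σ k)).withDensity (coordLik n (y k)) = c k • P k) :
    posterior φ n (prior φ dens σ n) y = (Measure.pi P).map (synth φ (truncLevel n)) := by
  have hT := measurableEmbedding_synth φ (truncLevel n)
  have hfin : ∀ k : Fin (truncLevel n),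
      IsFiniteMeasure ((coordLaw dens (σ k)).withDensity (coordLik n (y k))) := fun k => by
    rw [hP k]; exact Measure.smul_finite _ (hc k)
  have hpi : (Measure.pi fun k : Fin (truncLevel n) => coordLaw dens (σ k)).withDensity
      (fun θ => lik φ n (synth φ (truncLevel n) θ) y) = (∏ k, c k) • Measure.pi P := by
    simp_rw [lik_synth]
    rw [pi_withDensity_prod (fun k : Fin (truncLevel n) => coordLaw dens (σ k))
      (fun k => measurable_coordLik n (y k))]
    simp_rw [hP]
    exact pi_smul_measure P c hc
  have hprior : (prior φ dens σ n) =
      (Measure.pi fun k : Fin (truncLevel n) => coordLaw dens (σ k)).map (synth φ (truncLevel n)) := rfl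
  have hwd : (prior φ dens σ n).withDensity (fun f => lik φ n f y) =
      ((∏ k, c k) • Measure.pi P).map (synth φ (truncLevel n)) := by
    rw [← hpi]
    ext B hB
    rw [withDensity_apply _ hB, hprior, hT.restrict_map, hT.lintegral_map,
      Measure.map_apply hT.measurable hB, withDensity_apply _ (hT.measurable hB)]
  have hc0' : ∏ k, c k ≠ 0 := Finset.prod_ne_zero_iff.mpr fun k _ => hc0 k
  have hc' : ∏ k, c k ≠ ∞ := ENNReal.prod_ne_top fun k _ => hc k
  have hev : ∫⁻ f, lik φ n f y ∂(prior φ dens σ n) =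
      ((∏ k, c k) • (Measure.pi P).map (synth φ (truncLevel n))) Set.univ := by
    rw [← Measure.map_smul, ← hwd, withDensity_apply _ .univ, Measure.restrict_univ]
  have : IsProbabilityMeasure ((Measure.pi P).map (synth φ (truncLevel n))) :=
    Measure.isProbabilityMeasure_map hT.measurable.aemeasurable
  rw [posterior, hev, hwd, Measure.map_smul]
  exact inv_univ_smul_smul _ hc0' hc'

/-! ### Bounded Lipschitz distance and couplings -/

lemma integral_abs_le_sqrt {Ω : Type*} [MeasurableSpace Ω] {μ : Measure Ω} [IsProbabilityMeasure μ]
    {f : Ω → ℝ} (hf : MemLp f 2 μ) : ∫ ω, |f ω| ∂μ ≤ √(∫ ω, f ω ^ 2 ∂μ) := by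
  refine Real.le_sqrt_of_sq_le ?_
  have h := variance_nonneg (fun ω => |f ω|) μ
  rw [variance_eq_sub (X := fun ω => |f ω|) hf.abs] at h
  simp only [Pi.pow_apply, sq_abs] at h
  linarith

lemma blDist_le {μ ν : Measure ℝ} {B : ℝ} (hB : 0 ≤ B)
    (h : ∀ (F : ℝ → ℝ) (A : ℝ), (∀ x, |F x| ≤ A) → LipschitzWith 1 F →
      |(∫ x, F x ∂μ) - ∫ x, F x ∂ν| ≤ B) : blDist μ ν ≤ B := by
  refine Real.sSup_le ?_ hB
  rintro r ⟨F, A, L, hAL, hA, hL, rfl⟩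
  exact h F A hA (hL.weaken (le_trans (le_add_of_nonneg_left A.2) hAL))

lemma abs_integral_comp_sub_le {Ω : Type*} [MeasurableSpace Ω] {μ : Measure Ω}
    [IsProbabilityMeasure μ] {F : ℝ → ℝ} {A : ℝ} (hA : ∀ x, |F x| ≤ A) (hF : LipschitzWith 1 F)
    {X Z : Ω → ℝ} (hX : Measurable X) (hZ : Measurable Z)
    (hXZ : Integrable (fun ω => X ω - Z ω) μ) :
    |(∫ ω, F (X ω) ∂μ) - ∫ ω, F (Z ω) ∂μ| ≤ ∫ ω, |X ω - Z ω| ∂μ := by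
  have hFi : ∀ {V : Ω → ℝ}, Measurable V → Integrable (fun ω => F (V ω)) μ := fun hV =>
    Integrable.of_bound (hF.continuous.measurable.comp hV).aestronglyMeasurable A
      (ae_of_all _ fun ω => hA _)
  rw [← integral_sub (hFi hX) (hFi hZ)]
  refine (abs_integral_le_integral_abs).trans
    (integral_mono_of_nonneg (ae_of_all _ fun _ => abs_nonneg _) hXZ.abs (ae_of_all _ fun ω => ?_))
  simpa [Real.dist_eq] using hF.dist_le_mul (X ω) (Z ω)

/-! ### Moments and linear images of standard normal coordinates -/

/-- The variance of the square of a standard normal variable. -/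
noncomputable def normalSqVar : ℝ := Var[fun x => x ^ 2; gaussianReal 0 1]

lemma memLp_id_gaussian {m : ℝ} {v : ℝ≥0} {p : ℝ≥0∞} (hp : p ≠ ∞) :
    MemLp (fun x : ℝ => x) p (gaussianReal m v) := memLp_id_gaussianReal' p hp

lemma integrable_sq_gaussian (m : ℝ) (v : ℝ≥0) :
    Integrable (fun x => x ^ 2) (gaussianReal m v) :=
  (memLp_id_gaussian (p := 2) (by simp)).integrable_sq

lemma integral_sq_gaussian (m : ℝ) (v : ℝ≥0) :
    ∫ x, x ^ 2 ∂gaussianReal m v = m ^ 2 + v := by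
  have h := variance_eq_sub (memLp_id_gaussian (m := m) (v := v) (p := 2) (by simp))
  simp only [variance_fun_id_gaussianReal, Pi.pow_apply, integral_id_gaussianReal] at h
  linarith

lemma memLp_sq_gaussian (m : ℝ) (v : ℝ≥0) :
    MemLp (fun x : ℝ => x ^ 2) 2 (gaussianReal m v) := by
  refine (memLp_two_iff_integrable_sq (by fun_prop)).mpr ?_
  have h := (memLp_id_gaussian (m := m) (v := v) (p := 4) (by simp)).integrable_norm_pow'
  refine h.congr (ae_of_all _ fun x => ?_)
  simp only [Real.norm_eq_abs]
  rw [(by decide : Even 4).pow_abs, ← pow_mul]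

lemma integral_abs_sum_sq_sub_one_le {K : ℕ} (π : Fin K → Measure (ℝ × ℝ))
    [∀ k, IsProbabilityMeasure (π k)] (hsnd : ∀ k, (π k).map Prod.snd = gaussianReal 0 1) :
    Integrable (fun w => ∑ k, ((w k).2 ^ 2 - 1)) (Measure.pi π) ∧
      ∫ w, |∑ k, ((w k).2 ^ 2 - 1)| ∂Measure.pi π ≤ √(normalSqVar * K) := by
  have hmp : ∀ k, MeasurePreserving Prod.snd (π k) (gaussianReal 0 1) :=
    fun k => ⟨measurable_snd, hsnd k⟩
  have hL : ∀ k, MemLp (fun p : ℝ × ℝ => p.2 ^ 2 - 1) 2 (π k) := fun k =>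
    ((memLp_sq_gaussian 0 1).sub (memLp_const 1)).comp_measurePreserving (hmp k)
  have hL' : ∀ k, MemLp (fun w : Fin K → ℝ × ℝ => (w k).2 ^ 2 - 1) 2 (Measure.pi π) := fun k =>
    (hL k).comp_measurePreserving (measurePreserving_eval π k)
  have hS : MemLp (fun w : Fin K → ℝ × ℝ => ∑ k, ((w k).2 ^ 2 - 1)) 2 (Measure.pi π) :=
    memLp_finsetSum _ fun k _ => hL' k
  have hmean : ∫ w, ∑ k, ((w k).2 ^ 2 - 1) ∂Measure.pi π = 0 := by
    rw [integral_finsetSum _ fun k _ => (hL' k).integrable (by simp)]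
    refine Finset.sum_eq_zero fun k _ => ?_
    have h1 : ∫ w, ((w k).2 ^ 2 - 1) ∂Measure.pi π = ∫ x, (x ^ 2 - 1) ∂gaussianReal 0 1 := by
      rw [integral_comp_eval (μ := π) (i := k) (f := fun p => p.2 ^ 2 - 1) (by fun_prop), ← hsnd k,
        integral_map (by fun_prop) (by fun_prop)]
    rw [h1, integral_sub (integrable_sq_gaussian 0 1) (integrable_const _), integral_sq_gaussian]
    simp
  have hvar : Var[fun w : Fin K → ℝ × ℝ => ∑ k, ((w k).2 ^ 2 - 1); Measure.pi π] =
      normalSqVar * K := by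
    have h := variance_sum_pi hL
    have h2 : ∀ k, Var[fun p : ℝ × ℝ => p.2 ^ 2 - 1; π k] = normalSqVar := fun k => by
      rw [variance_sub_const (X := fun p : ℝ × ℝ => p.2 ^ 2) (by fun_prop), normalSqVar,
        ← hsnd k, variance_map (by fun_prop) (by fun_prop)]
      rfl
    simp only [h2, Finset.sum_const, Finset.card_univ, Fintype.card_fin, nsmul_eq_mul] at h
    rw [mul_comm, ← h]
    congr 1
    funext w
    simp
  refine ⟨hS.integrable (by simp), (integral_abs_le_sqrt hS).trans (le_of_eq ?_)⟩
  rw [variance_eq_sub hS, hmean] at hvar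
  congr 1
  simpa using hvar

/-- The law is written as an image of `N(0, 1)`, which also covers `y = 0` and lets two such laws be
compared by their standard deviations. -/
lemma map_linear_eq_gaussian {K : ℕ} (π : Fin K → Measure (ℝ × ℝ))
    [∀ k, IsProbabilityMeasure (π k)] (hsnd : ∀ k, (π k).map Prod.snd = gaussianReal 0 1)
    (y : Fin K → ℝ) :
    (Measure.pi π).map (fun w => ∑ k, 2 * y k * (w k).2) =
      (gaussianReal 0 1).map fun x => 2 * √(∑ k, y k ^ 2) * x := by
  have hmp : ∀ k, MeasurePreserving Prod.snd (π k) (gaussianReal 0 1) :=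
    fun k => ⟨measurable_snd, hsnd k⟩
  have hmap : ∀ k, (π k).map (fun p => 2 * y k * p.2) =
      gaussianReal 0 (.mk ((2 * y k) ^ 2) (sq_nonneg _)) := fun k => by
    have h : (fun p : ℝ × ℝ => 2 * y k * p.2) = (fun x => 2 * y k * x) ∘ Prod.snd := rfl
    rw [h, ← Measure.map_map (by fun_prop) (by fun_prop), hsnd k, gaussianReal_map_const_mul]
    simp
  have hL : ∀ k, MemLp (fun p : ℝ × ℝ => 2 * y k * p.2) 2 (π k) := fun k =>
    ((memLp_id_gaussian (by simp)).const_mul (2 * y k)).comp_measurePreserving (hmp k)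
  have hg : ∀ k, HasGaussianLaw (fun w : Fin K → ℝ × ℝ => 2 * y k * (w k).2) (Measure.pi π) :=
    fun k => by
      refine ⟨?_⟩
      have h : (fun w : Fin K → ℝ × ℝ => 2 * y k * (w k).2) =
        (fun p : ℝ × ℝ => 2 * y k * p.2) ∘ Function.eval k := rfl
      rw [h, ← Measure.map_map (by fun_prop) (by fun_prop), (measurePreserving_eval π k).map_eq,
        hmap k]
      infer_instance
  have hi : iIndepFun (fun k (w : Fin K → ℝ × ℝ) => 2 * y k * (w k).2) (Measure.pi π) :=
    iIndepFun_pi (X := fun k (p : ℝ × ℝ) => 2 * y k * p.2) fun k => by fun_prop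
  rw [(iIndepFun.hasGaussianLaw_fun_sum hg hi).map_eq_gaussianReal, gaussianReal_map_const_mul]
  have hmean : ∫ w, ∑ k, 2 * y k * (w k).2 ∂Measure.pi π = 0 := by
    rw [integral_finsetSum _ fun k _ => (hg k).integrable]
    refine Finset.sum_eq_zero fun k _ => ?_
    have h1 : ∫ w, 2 * y k * (w k).2 ∂Measure.pi π = ∫ x, 2 * y k * x ∂gaussianReal 0 1 := by
      rw [integral_comp_eval (μ := π) (i := k) (f := fun p => 2 * y k * p.2) (by fun_prop), ← hsnd k,
        integral_map (by fun_prop) (by fun_prop)]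
    rw [h1, integral_const_mul, integral_id_gaussianReal, mul_zero]
  have hvar : Var[fun w : Fin K → ℝ × ℝ => ∑ k, 2 * y k * (w k).2; Measure.pi π] =
      4 * ∑ k, y k ^ 2 := by
    have h := variance_sum_pi hL
    have h2 : ∀ k, Var[fun p : ℝ × ℝ => 2 * y k * p.2; π k] = 4 * y k ^ 2 := fun k => by
      have h3 := variance_map (X := fun x : ℝ => x) (Y := fun p : ℝ × ℝ => 2 * y k * p.2)
        (μ := π k) (by fun_prop) (by fun_prop)
      rw [hmap k, variance_fun_id_gaussianReal] at h3
      refine h3.symm.trans ?_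
      simp only [NNReal.coe_mk]
      ring
    simp only [h2, ← Finset.mul_sum] at h
    rw [← h]
    congr 1
    funext w
    simp
  rw [hmean, hvar, mul_zero]
  congr 1
  apply NNReal.coe_injective
  have hs : 0 ≤ ∑ k, y k ^ 2 := Finset.sum_nonneg fun _ _ => sq_nonneg _
  simp only [Real.coe_toNNReal', NNReal.coe_mul, NNReal.coe_mk, NNReal.coe_one, mul_pow,
    Real.sq_sqrt hs]
  rw [max_eq_left (by positivity)]
  ring

/-- Coupling bound: if each coordinate law is coupled with a standard normal `ξ_k` so that the
coordinate is close to `y_k + ξ_k / √n` in the sense of squares, then the centred and scaled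
squared norm is close to the linear statistic `2 ∑ y_k ξ_k`, hence to a centred normal variable. -/
theorem blDist_pi_le {K n : ℕ} (hn : 0 < n) (y : Fin K → ℝ) (π : Fin K → Measure (ℝ × ℝ))
    [∀ k, IsProbabilityMeasure (π k)] (hsnd : ∀ k, (π k).map Prod.snd = gaussianReal 0 1)
    (hint : ∀ k, Integrable (fun p => p.1 ^ 2 - (y k + p.2 / √n) ^ 2) (π k)) (d : Fin K → ℝ)
    (hd : ∀ k, ∫ p, |p.1 ^ 2 - (y k + p.2 / √n) ^ 2| ∂π k ≤ d k) (a : ℝ≥0) :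
    blDist ((Measure.pi fun k => (π k).map Prod.fst).map fun θ =>
        √(n : ℝ) * (∑ k, θ k ^ 2 - ∑ k, (y k ^ 2 - 1 / (n : ℝ)) - 2 * (K : ℝ) / (n : ℝ)))
      (gaussianReal 0 (4 * a ^ 2)) ≤
    √n * ∑ k, d k + √(normalSqVar * K / n) + 2 * |√(∑ k, y k ^ 2) - a| := by
  have hn' : (0 : ℝ) < n := Nat.cast_pos.mpr hn
  have hsn : 0 < √(n : ℝ) := Real.sqrt_pos.mpr hn'
  have hsq : √(n : ℝ) ^ 2 = n := Real.sq_sqrt hn'.le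
  have hd0 : ∀ k, 0 ≤ d k := fun k => (integral_nonneg fun _ => abs_nonneg _).trans (hd k)
  have hD : 0 ≤ ∑ k, d k := Finset.sum_nonneg fun k _ => hd0 k
  refine blDist_le (by positivity) fun F A hA hF => ?_
  have hFm : Measurable F := hF.continuous.measurable
  set X : (Fin K → ℝ × ℝ) → ℝ := fun w =>
    √(n : ℝ) * (∑ k, (w k).1 ^ 2 - ∑ k, (y k ^ 2 - 1 / (n : ℝ)) - 2 * (K : ℝ) / (n : ℝ)) with hX
  set W : (Fin K → ℝ × ℝ) → ℝ := fun w => ∑ k, 2 * y k * (w k).2 with hW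
  have hXm : Measurable X := by fun_prop
  have hWm : Measurable W := by fun_prop
  have hprob : ∀ k, IsProbabilityMeasure ((π k).map Prod.fst) := fun k =>
    Measure.isProbabilityMeasure_map (by fun_prop)
  -- the law of the statistic, on the coupling space
  have e1 : ∫ x, F x ∂((Measure.pi fun k => (π k).map Prod.fst).map fun θ =>
        √(n : ℝ) * (∑ k, θ k ^ 2 - ∑ k, (y k ^ 2 - 1 / (n : ℝ)) - 2 * (K : ℝ) / (n : ℝ))) =
      ∫ w, F (X w) ∂Measure.pi π := by
    rw [← Measure.pi_map_pi (fun k => by fun_prop),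
      Measure.map_map (by fun_prop) (by fun_prop),
      integral_map (Measurable.aemeasurable (by fun_prop)) hFm.aestronglyMeasurable]
    rfl
  have e2 : ∫ w, F (W w) ∂Measure.pi π =
      ∫ x, F (2 * √(∑ k, y k ^ 2) * x) ∂gaussianReal 0 1 := by
    rw [← integral_map (φ := W) (by fun_prop) hFm.aestronglyMeasurable, hW,
      map_linear_eq_gaussian π hsnd y, integral_map (by fun_prop) hFm.aestronglyMeasurable]
  have e3 : ∫ x, F x ∂gaussianReal 0 (4 * a ^ 2) = ∫ x, F (2 * a * x) ∂gaussianReal 0 1 := by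
    have h : gaussianReal 0 (4 * a ^ 2) = (gaussianReal 0 1).map fun x => 2 * (a : ℝ) * x := by
      rw [gaussianReal_map_const_mul]
      congr 1
      · simp
      · apply NNReal.coe_injective
        simp only [NNReal.coe_mul, NNReal.coe_mk, NNReal.coe_one, NNReal.coe_pow,
          NNReal.coe_ofNat]
        ring
    rw [h, integral_map (by fun_prop) hFm.aestronglyMeasurable]
  -- the quadratic expansion around the observations
  have hXW : ∀ w, X w - W w = √(n : ℝ) * ∑ k, ((w k).1 ^ 2 - (y k + (w k).2 / √n) ^ 2) +
      (√(n : ℝ))⁻¹ * ∑ k, ((w k).2 ^ 2 - 1) := fun w => by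
    have h1 : ∀ k, (y k + (w k).2 / √n) ^ 2 = y k ^ 2 + (√(n : ℝ))⁻¹ * (2 * y k * (w k).2) +
        (n : ℝ)⁻¹ * (w k).2 ^ 2 := fun k => by
      have h2 : (n : ℝ)⁻¹ = (√(n : ℝ))⁻¹ ^ 2 := by rw [inv_pow, hsq]
      rw [h2]
      ring
    simp only [hX, hW, h1, Finset.sum_sub_distrib, Finset.sum_add_distrib, ← Finset.mul_sum,
      Finset.sum_const, Finset.card_univ, Fintype.card_fin, nsmul_eq_mul]
    set s := √(n : ℝ)
    rw [← hsq]
    field_simp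
    ring
  obtain ⟨hQi, hQ⟩ := integral_abs_sum_sq_sub_one_le π hsnd
  have hDi : ∀ k, Integrable
      (fun w : Fin K → ℝ × ℝ => (w k).1 ^ 2 - (y k + (w k).2 / √n) ^ 2) (Measure.pi π) := fun k =>
    (measurePreserving_eval π k).integrable_comp_of_integrable (hint k)
  have hDs := integrable_finsetSum Finset.univ fun k _ => hDi k
  have hDl : ∀ k, ∫ w, |(w k).1 ^ 2 - (y k + (w k).2 / √n) ^ 2| ∂Measure.pi π ≤ d k := fun k => by
    refine le_trans (le_of_eq ?_) (hd k)
    exact integral_comp_eval (μ := π) (i := k)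
      (f := fun p => |p.1 ^ 2 - (y k + p.2 / √n) ^ 2|) (by fun_prop)
  have hXWi : Integrable (fun w => X w - W w) (Measure.pi π) := by
    simp_rw [hXW]
    exact (hDs.const_mul _).add (hQi.const_mul _)
  have b1 : |(∫ w, F (X w) ∂Measure.pi π) - ∫ w, F (W w) ∂Measure.pi π| ≤
      √n * ∑ k, d k + √(normalSqVar * K / n) := by
    refine (abs_integral_comp_sub_le hA hF hXm hWm hXWi).trans ?_
    have hb : ∀ w, |X w - W w| ≤ √(n : ℝ) * ∑ k, |(w k).1 ^ 2 - (y k + (w k).2 / √n) ^ 2| +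
        (√(n : ℝ))⁻¹ * |∑ k, ((w k).2 ^ 2 - 1)| := fun w => by
      rw [hXW w]
      refine (abs_add_le _ _).trans (add_le_add ?_ ?_)
      · rw [abs_mul, abs_of_pos hsn]
        exact mul_le_mul_of_nonneg_left (Finset.abs_sum_le_sum_abs _ _) hsn.le
      · rw [abs_mul, abs_of_pos (inv_pos.mpr hsn)]
    have hDa := integrable_finsetSum Finset.univ fun k _ => (hDi k).abs
    refine (integral_mono hXWi.abs ((hDa.const_mul _).add (hQi.abs.const_mul _)) hb).trans ?_
    simp only [Pi.add_apply]
    rw [integral_add (hDa.const_mul _) (hQi.abs.const_mul _), integral_const_mul,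
      integral_const_mul, integral_finsetSum _ fun k _ => (hDi k).abs]
    refine add_le_add (mul_le_mul_of_nonneg_left (Finset.sum_le_sum fun k _ => hDl k) hsn.le) ?_
    rw [Real.sqrt_div' _ hn'.le, div_eq_inv_mul]
    exact mul_le_mul_of_nonneg_left hQ (inv_nonneg.mpr hsn.le)
  have b2 : |(∫ x, F (2 * √(∑ k, y k ^ 2) * x) ∂gaussianReal 0 1) -
      ∫ x, F (2 * a * x) ∂gaussianReal 0 1| ≤ 2 * |√(∑ k, y k ^ 2) - a| := by
    have hid : MemLp (fun x : ℝ => x) 2 (gaussianReal 0 1) := memLp_id_gaussian (by simp)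
    have h1 : ∀ x : ℝ, 2 * √(∑ k, y k ^ 2) * x - 2 * a * x =
        2 * (√(∑ k, y k ^ 2) - a) * x := fun x => by ring
    refine (abs_integral_comp_sub_le hA hF (by fun_prop) (by fun_prop) ?_).trans ?_
    · simp_rw [h1]
      exact (hid.integrable (by simp)).const_mul _
    · simp_rw [h1, abs_mul]
      rw [integral_const_mul]
      have h2 := integral_abs_le_sqrt hid
      rw [integral_sq_gaussian] at h2
      have h3 : ∫ x : ℝ, |x| ∂gaussianReal 0 1 ≤ 1 := by simpa using h2
      rw [abs_two]
      exact mul_le_of_le_one_right (by positivity) h3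
  rw [e1, e3]
  rw [e2] at b1
  exact (abs_sub_le _ _ _).trans (add_le_add b1 b2)

/-! ### Asymptotics of the truncation level -/

lemma tendsto_log_natCast : Tendsto (fun n : ℕ => Real.log n) atTop atTop :=
  Real.tendsto_log_atTop.comp tendsto_natCast_atTop_atTop

lemma tendsto_truncLevel_div :
    Tendsto (fun n : ℕ => (truncLevel n : ℝ) / n) atTop (𝓝 0) := by
  refine squeeze_zero' (.of_forall fun n => by positivity) ?_ tendsto_log_natCast.inv_tendsto_atTop
  filter_upwards [eventually_gt_atTop 1] with n hn
  have hn' : (1 : ℝ) < n := by exact_mod_cast hn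
  have hl : 0 < Real.log n := Real.log_pos hn'
  rw [div_le_iff₀ (by linarith)]
  refine (Nat.floor_le (by positivity)).trans (le_of_eq ?_)
  simp only [Pi.inv_apply]
  field_simp

lemma tendsto_truncLevel : Tendsto truncLevel atTop atTop := by
  have h : Tendsto (fun n : ℕ => (n : ℝ) / Real.log n) atTop atTop := by
    have h1 : Tendsto (fun x : ℝ => Real.log x / x) atTop (𝓝[>] 0) := by
      refine tendsto_nhdsWithin_iff.mpr ⟨?_, ?_⟩
      · simpa using Real.isLittleO_log_id_atTop.tendsto_div_nhds_zero
      · filter_upwards [eventually_gt_atTop 1] with x hx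
        exact div_pos (Real.log_pos hx) (by linarith)
    have h2 := h1.inv_tendsto_nhdsGT_zero.comp (tendsto_natCast_atTop_atTop (R := ℝ))
    refine h2.congr fun n => ?_
    simp
  exact tendsto_nat_floor_atTop.comp h

lemma truncLevel_le {n : ℕ} (hn : 3 ≤ n) : truncLevel n ≤ n := by
  have hn' : (3 : ℝ) ≤ n := by exact_mod_cast hn
  have hl : 1 ≤ Real.log n := by
    rw [Real.le_log_iff_exp_le (by linarith)]
    linarith [Real.exp_one_lt_d9]
  refine Nat.floor_le_of_le ?_
  exact div_le_self (by linarith) hl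

/-! ### Reduction to couplings of the coordinates -/

/-- The posterior law of a coordinate, with prior `coordLaw dens s` and observation `y`, has a
coupling with a standard normal variable `ξ` such that the squares of the coordinate and of
`y + ξ / √n` differ by at most `δ` in mean. The joint law is `π`; that its first marginal is the
posterior law is expressed by saying that the tilted prior is a multiple `c` of it. -/
def CoordCoupling (dens : ℝ → ℝ) (s : ℝ) (n : ℕ) (y δ : ℝ) : Prop :=
  ∃ (π : Measure (ℝ × ℝ)) (c : ℝ≥0∞), IsProbabilityMeasure π ∧ c ≠ 0 ∧ c ≠ ∞ ∧
    (coordLaw dens s).withDensity (coordLik n y) = c • π.map Prod.fst ∧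
    π.map Prod.snd = gaussianReal 0 1 ∧
    Integrable (fun p => p.1 ^ 2 - (y + p.2 / √n) ^ 2) π ∧
    ∫ p, |p.1 ^ 2 - (y + p.2 / √n) ^ 2| ∂π ≤ δ

lemma CoordCoupling.nonneg {dens : ℝ → ℝ} {s : ℝ} {n : ℕ} {y δ : ℝ}
    (h : CoordCoupling dens s n y δ) : 0 ≤ δ := by
  obtain ⟨π, c, -, -, -, -, -, -, h⟩ := h
  exact (integral_nonneg fun _ => abs_nonneg _).trans h

lemma measurePreserving_obs (φ : HilbertBasis ℕ ℝ L2) (n : ℕ) (f : L2) (k : ℕ) :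
    MeasurePreserving (fun y : ℕ → ℝ => y k) (obsLaw φ n f)
      (gaussianReal (coef φ f k) (1 / (n : ℝ≥0))) :=
  measurePreserving_eval_infinitePi _ k

instance (φ : HilbertBasis ℕ ℝ L2) (n : ℕ) (f : L2) : IsProbabilityMeasure (obsLaw φ n f) := by
  unfold obsLaw
  infer_instance

lemma integral_obs_comp (φ : HilbertBasis ℕ ℝ L2) (n : ℕ) (f : L2) (k : ℕ) {g : ℝ → ℝ}
    (hg : AEStronglyMeasurable g (gaussianReal (coef φ f k) (1 / (n : ℝ≥0)))) :
    ∫ y, g (y k) ∂obsLaw φ n f = ∫ x, g x ∂gaussianReal (coef φ f k) (1 / (n : ℝ≥0)) := by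
  have h := (measurePreserving_obs φ n f k).map_eq
  rw [← h] at hg ⊢
  exact (integral_map (measurable_pi_apply k).aemeasurable hg).symm

lemma abs_sqrt_sum_sq_sub_le {K : ℕ} (y f : Fin K → ℝ) :
    |√(∑ k, y k ^ 2) - √(∑ k, f k ^ 2)| ≤ √(∑ k, (y k - f k) ^ 2) := by
  have h := abs_norm_sub_norm_le (WithLp.toLp 2 y) (WithLp.toLp 2 f)
  simpa [EuclideanSpace.norm_eq, ← WithLp.toLp_sub] using h

lemma integral_sqrt_sum_sq_noise_le (φ : HilbertBasis ℕ ℝ L2) (n K : ℕ) (f : L2) :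
    Integrable (fun y => √(∑ k : Fin K, (y k - coef φ f k) ^ 2)) (obsLaw φ n f) ∧
      ∫ y, √(∑ k : Fin K, (y k - coef φ f k) ^ 2) ∂obsLaw φ n f ≤ √((K : ℝ) / n) := by
  have hi : ∀ k : Fin K, Integrable (fun x => (x - coef φ f k) ^ 2)
      (gaussianReal (coef φ f k) (1 / (n : ℝ≥0))) := fun k =>
    ((memLp_id_gaussian (p := 2) (by simp)).sub (memLp_const _)).integrable_sq
  have hi' : ∀ k : Fin K, Integrable (fun y : ℕ → ℝ => (y k - coef φ f k) ^ 2) (obsLaw φ n f) :=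
    fun k => (measurePreserving_obs φ n f k).integrable_comp_of_integrable (hi k)
  have h0 : ∀ y : ℕ → ℝ, 0 ≤ ∑ k : Fin K, (y k - coef φ f k) ^ 2 := fun y =>
    Finset.sum_nonneg fun _ _ => sq_nonneg _
  have hL : MemLp (fun y => √(∑ k : Fin K, (y k - coef φ f k) ^ 2)) 2 (obsLaw φ n f) := by
    have hm : Measurable fun y : ℕ → ℝ => √(∑ k : Fin K, (y k - coef φ f k) ^ 2) :=
      Measurable.sqrt (by fun_prop)
    refine (memLp_two_iff_integrable_sq hm.aestronglyMeasurable).mpr ?_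
    simp_rw [fun y => Real.sq_sqrt (h0 y)]
    exact integrable_finsetSum _ fun k _ => hi' k
  refine ⟨hL.integrable (by simp), ?_⟩
  have h := integral_abs_le_sqrt hL
  simp_rw [fun y => Real.sq_sqrt (h0 y), abs_of_nonneg (Real.sqrt_nonneg _)] at h
  refine h.trans (Real.sqrt_le_sqrt (le_of_eq ?_))
  rw [integral_finsetSum _ fun k _ => hi' k]
  have h1 : ∀ k : Fin K, ∫ y, (y k - coef φ f k) ^ 2 ∂obsLaw φ n f = 1 / n := fun k => by
    rw [integral_obs_comp φ n f k (g := fun x => (x - coef φ f k) ^ 2) (by fun_prop)]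
    have h2 := variance_fun_id_gaussianReal (μ := coef φ f k) (v := 1 / (n : ℝ≥0))
    rw [variance_eq_integral (by fun_prop), integral_id_gaussianReal] at h2
    simpa using h2
  simp [h1, div_eq_mul_inv]

lemma tendsto_sqrt_sum_coef (φ : HilbertBasis ℕ ℝ L2) (f : L2) :
    Tendsto (fun n : ℕ => √(∑ k : Fin (truncLevel n), coef φ f k ^ 2)) atTop (𝓝 ‖f‖) := by
  have h := (φ.hasSum_inner_mul_inner f f).tendsto_sum_nat.comp tendsto_truncLevel
  have h2 := (Real.continuous_sqrt.tendsto _).comp h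
  rw [real_inner_self_eq_norm_sq, Real.sqrt_sq (norm_nonneg _)] at h2
  refine h2.congr fun n => ?_
  simp only [Function.comp_apply]
  rw [Finset.sum_range]
  congr 1
  refine Finset.sum_congr rfl fun k _ => ?_
  rw [coef, sq, real_inner_comm]

/-- For coordinates coupled with shifted normal variables, the posterior law is within the sum of
the coupling errors, the size of the quadratic remainder and the fluctuation of the norm of the
observed signal. -/
lemma blDist_posterior_le (φ : HilbertBasis ℕ ℝ L2) (dens : ℝ → ℝ) (σ : ℕ → ℝ) (f₀ : L2)
    (hprob : ∀ k, IsProbabilityMeasure (coordLaw dens (σ k))) {n : ℕ} (hn : 0 < n) (y : ℕ → ℝ)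
    (d : Fin (truncLevel n) → ℝ)
    (hd : ∀ k : Fin (truncLevel n), CoordCoupling dens (σ k) n (y k) (d k)) :
    blDist ((posterior φ n (prior φ dens σ n) y).map fun f =>
        √(n : ℝ) * (‖f‖ ^ 2 - psiBar n y - 2 * (truncLevel n : ℝ) / (n : ℝ)))
      (gaussianReal 0 (4 * ‖f₀‖₊ ^ 2)) ≤
    √n * ∑ k, d k + √(normalSqVar * truncLevel n / n) +
      2 * (√(∑ k : Fin (truncLevel n), (y k - coef φ f₀ k) ^ 2) +
        |√(∑ k : Fin (truncLevel n), coef φ f₀ k ^ 2) - ‖f₀‖|) := by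
  choose π c hπ hc0 hc hP hsnd hint hle using hd
  have hP' : ∀ k, IsProbabilityMeasure ((π k).map Prod.fst) := fun k =>
    Measure.isProbabilityMeasure_map (by fun_prop)
  rw [posterior_prior_eq φ dens σ n y hprob (fun k => (π k).map Prod.fst) c hc0 hc hP,
    Measure.map_map (by fun_prop) (measurableEmbedding_synth φ _).measurable]
  have h1 : ((fun f : L2 => √(n : ℝ) * (‖f‖ ^ 2 - psiBar n y -
      2 * (truncLevel n : ℝ) / (n : ℝ))) ∘ synth φ (truncLevel n)) = fun θ =>
      √(n : ℝ) * (∑ k, θ k ^ 2 - ∑ k : Fin (truncLevel n), (y k ^ 2 - 1 / (n : ℝ)) -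
        2 * (truncLevel n : ℝ) / (n : ℝ)) := by
    funext θ
    simp only [Function.comp_apply, norm_sq_synth, psiBar, Finset.sum_range]
  rw [h1]
  refine (blDist_pi_le hn (fun k => y k) π hsnd hint d hle ‖f₀‖₊).trans ?_
  gcongr
  refine (abs_sub_le _ (√(∑ k : Fin (truncLevel n), coef φ f₀ k ^ 2)) _).trans ?_
  rw [coe_nnnorm]
  gcongr
  exact abs_sqrt_sum_sq_sub_le (fun k : Fin (truncLevel n) => y k) fun k => coef φ f₀ k

/-- The posterior converges as soon as the coordinatewise coupling errors `d n k`, averaged over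
the observation, add up to `o(1 / √n)`. -/
theorem bvM_of_coordCoupling (φ : HilbertBasis ℕ ℝ L2) (dens : ℝ → ℝ) (σ : ℕ → ℝ) (f₀ : L2)
    (hprob : ∀ k, IsProbabilityMeasure (coordLaw dens (σ k)))
    (d : ℕ → ℕ → ℝ → ℝ) (D : ℕ → ℕ → ℝ)
    (hd : ∀ᶠ n : ℕ in atTop, ∀ k < truncLevel n,
      (∀ y, CoordCoupling dens (σ k) n y (d n k y)) ∧
      Integrable (d n k) (gaussianReal (coef φ f₀ k) (1 / (n : ℝ≥0))) ∧
      ∫ y, d n k y ∂gaussianReal (coef φ f₀ k) (1 / (n : ℝ≥0)) ≤ D n k)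
    (hD : Tendsto (fun n : ℕ => √n * ∑ k ∈ Finset.range (truncLevel n), D n k) atTop (𝓝 0)) :
    BvM φ dens σ f₀ := by
  intro δ hδ
  set R : ℕ → ℝ := fun n => |√(∑ k : Fin (truncLevel n), coef φ f₀ k ^ 2) - ‖f₀‖| with hR
  set B : ℕ → ℝ := fun n => √n * ∑ k ∈ Finset.range (truncLevel n), D n k +
    √(normalSqVar * truncLevel n / n) + 2 * (√((truncLevel n : ℝ) / n) + R n) with hB
  have hR0 : Tendsto R atTop (𝓝 0) := by
    have h := ((tendsto_sqrt_sum_coef φ f₀).sub_const ‖f₀‖).abs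
    simpa using h
  have hK0 : Tendsto (fun n : ℕ => √((truncLevel n : ℝ) / n)) atTop (𝓝 0) := by
    have h := (Real.continuous_sqrt.tendsto _).comp tendsto_truncLevel_div
    rwa [Real.sqrt_zero] at h
  have hV0 : Tendsto (fun n : ℕ => √(normalSqVar * truncLevel n / n)) atTop (𝓝 0) := by
    have h := (Real.continuous_sqrt.tendsto _).comp (tendsto_truncLevel_div.const_mul normalSqVar)
    rw [mul_zero, Real.sqrt_zero] at h
    simpa only [Function.comp_def, mul_div_assoc] using h
  have hB0 : Tendsto B atTop (𝓝 0) := by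
    have h := (hD.add hV0).add ((hK0.add hR0).const_mul 2)
    simpa only [add_zero, mul_zero] using h
  have hlim : Tendsto (fun n => ENNReal.ofReal (B n / δ)) atTop (𝓝 0) := by
    simpa using ENNReal.tendsto_ofReal (hB0.div_const δ)
  refine tendsto_of_tendsto_of_tendsto_of_le_of_le' tendsto_const_nhds hlim
    (.of_forall fun _ => zero_le) ?_
  filter_upwards [hd, eventually_gt_atTop 0] with n hdn hn
  set U : (ℕ → ℝ) → ℝ := fun y => √n * ∑ k : Fin (truncLevel n), d n k (y k) +
    √(normalSqVar * truncLevel n / n) +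
      2 * (√(∑ k : Fin (truncLevel n), (y k - coef φ f₀ k) ^ 2) + R n) with hU
  have hdi : ∀ k : Fin (truncLevel n), Integrable (fun y : ℕ → ℝ => d n k (y k)) (obsLaw φ n f₀) :=
    fun k => (measurePreserving_obs φ n f₀ k).integrable_comp_of_integrable (hdn k k.2).2.1
  have hds := (integrable_finsetSum Finset.univ fun k _ => hdi k).const_mul √n
  obtain ⟨hNi, hN⟩ := integral_sqrt_sum_sq_noise_le φ n (truncLevel n) f₀
  have hi1 := hds.add (integrable_const √(normalSqVar * truncLevel n / n))
  have hi2 := (hNi.add (integrable_const (R n))).const_mul 2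
  have hUi : Integrable U (obsLaw φ n f₀) := hi1.add hi2
  have hU0 : ∀ y, 0 ≤ U y := fun y => by
    have h1 : 0 ≤ ∑ k : Fin (truncLevel n), d n k (y k) :=
      Finset.sum_nonneg fun k _ => ((hdn k k.2).1 _).nonneg
    have h2 : 0 ≤ R n := abs_nonneg _
    positivity
  have hUB : ∫ y, U y ∂obsLaw φ n f₀ ≤ B n := by
    have e : ∫ y, U y ∂obsLaw φ n f₀ = √n * ∑ k : Fin (truncLevel n),
        ∫ x, d n k x ∂gaussianReal (coef φ f₀ k) (1 / (n : ℝ≥0)) +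
        √(normalSqVar * truncLevel n / n) +
        2 * (∫ y, √(∑ k : Fin (truncLevel n), (y k - coef φ f₀ k) ^ 2) ∂obsLaw φ n f₀ + R n) := by
      refine (integral_add hi1 hi2).trans ?_
      congr 1
      · refine (integral_add hds (integrable_const _)).trans ?_
        rw [integral_const_mul, integral_finsetSum _ fun k _ => hdi k]
        simp only [integral_const, probReal_univ, smul_eq_mul, one_mul]
        congr 2
        exact Finset.sum_congr rfl fun k _ =>
          integral_obs_comp φ n f₀ k (hdn k k.2).2.1.aestronglyMeasurable
      · rw [integral_const_mul]
        congr 1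
        refine (integral_add hNi (integrable_const _)).trans ?_
        simp
    rw [e, hB]
    simp only [Finset.sum_range]
    gcongr with k
    exact (hdn k k.2).2.2
  have hsub : {y | δ < blDist
      ((posterior φ n (prior φ dens σ n) y).map fun f =>
        √(n : ℝ) * (‖f‖ ^ 2 - psiBar n y - 2 * (truncLevel n : ℝ) / (n : ℝ)))
      (gaussianReal 0 (4 * ‖f₀‖₊ ^ 2))} ⊆ {y | δ ≤ U y} := fun y hy =>
    hy.le.trans (blDist_posterior_le φ dens σ f₀ hprob hn y (fun k => d n k (y k))
      fun k => (hdn k k.2).1 (y k))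
  refine (measure_mono hsub).trans ?_
  have hmk := mul_meas_ge_le_integral_of_nonneg (ae_of_all _ hU0) hUi δ
  rw [← ofReal_measureReal]
  exact ENNReal.ofReal_le_ofReal ((le_div_iff₀' hδ).mpr (hmk.trans hUB))

/-! ### Gaussian prior -/

lemma isProbabilityMeasure_coordLaw_gaussDens {s : ℝ} (hs : 0 < s) :
    IsProbabilityMeasure (coordLaw gaussDens s) := by
  have hv : (.mk (s ^ 2) (sq_nonneg s) : ℝ≥0) ≠ 0 := fun h => by
    have := congrArg NNReal.toReal h
    simp only [NNReal.coe_mk, NNReal.coe_zero] at this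
    exact hs.ne' (by simpa using this)
  have h : coordLaw gaussDens s = gaussianReal 0 (.mk (s ^ 2) (sq_nonneg s)) := by
    rw [gaussianReal_of_var_ne_zero _ hv, coordLaw]
    congr 1
    funext x
    rw [gaussianPDF, gaussDens]
    congr 1
    simp only [gaussianPDFReal, NNReal.coe_mk, NNReal.coe_one, mul_one, sub_zero]
    rw [Real.sqrt_mul' _ (sq_nonneg s), Real.sqrt_sq hs.le, ← mul_assoc]
    congr 1
    · field_simp
    · congr 1
      field_simp
  rw [h]
  infer_instance

lemma coordLaw_gaussDens_tilt {s : ℝ} (hs : 0 < s) {n : ℕ} (hn : 0 < n) (y : ℝ) {v : ℝ≥0}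
    (hv : (v : ℝ) = (n + (s ^ 2)⁻¹)⁻¹) :
    ∃ c : ℝ≥0∞, c ≠ 0 ∧ c ≠ ∞ ∧
      (coordLaw gaussDens s).withDensity (coordLik n y) = c • gaussianReal (n * y * v) v := by
  have hn' : (0 : ℝ) < n := Nat.cast_pos.mpr hn
  have hv0 : (0 : ℝ) < v := by rw [hv]; positivity
  have hv1 : (v : ℝ)⁻¹ = n + (s ^ 2)⁻¹ := by rw [hv, inv_inv]
  have hvne : v ≠ 0 := fun h => by rw [h] at hv0; simp at hv0
  set C : ℝ := 1 / s * (√(2 * Real.pi))⁻¹ * √(2 * Real.pi * v) *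
    Real.exp (n ^ 2 * y ^ 2 * v / 2) with hC
  have hC0 : 0 < C := by positivity
  refine ⟨ENNReal.ofReal C, by simpa using hC0, ENNReal.ofReal_ne_top, ?_⟩
  rw [gaussianReal_of_var_ne_zero _ hvne, coordLaw]
  refine withDensity_ofReal_mul _ _ (gaussianPDFReal (n * y * v) v) C ?_ (by fun_prop)
    (measurable_gaussianPDFReal _ _) ?_ hC0.le fun x => ?_
  · exact ((measurable_gaussianPDFReal 0 1).comp (measurable_id.div_const s)).const_mul _
  · exact fun x => mul_nonneg (by positivity) (gaussianPDFReal_nonneg 0 1 _)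
  · simp only [gaussDens, gaussianPDFReal, NNReal.coe_one, mul_one, sub_zero, hC]
    have h2 : √(2 * Real.pi * v) ≠ 0 := by positivity
    have hexp : Real.exp (-(x / s) ^ 2 / 2) * Real.exp (n * (x * y) - n * x ^ 2 / 2) =
        Real.exp (n ^ 2 * y ^ 2 * v / 2) * Real.exp (-(x - n * y * v) ^ 2 / (2 * v)) := by
      rw [← Real.exp_add, ← Real.exp_add]
      congr 1
      have e1 : -(x - n * y * v) ^ 2 / (2 * v) =
          -(x ^ 2 * (v : ℝ)⁻¹) / 2 + n * y * x - n ^ 2 * y ^ 2 * v / 2 := by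
        field_simp
        ring
      rw [e1, hv1]
      field_simp
      ring
    rw [mul_assoc, mul_assoc, hexp]
    field_simp

/-- The coupled squares: `y + w` against the posterior draw `t ^ 2 * y + t * w`, whose mean is
shrunk by `t ^ 2` and whose standard deviation is shrunk by `t`. -/
lemma abs_sq_shrink_sub_sq_le {t : ℝ} (ht0 : 0 ≤ t) (ht1 : t ≤ 1) (y w : ℝ) :
    |(t ^ 2 * y + t * w) ^ 2 - (y + w) ^ 2| ≤ 4 * (1 - t ^ 2) * (y ^ 2 + w ^ 2) := by
  have hy0 := abs_nonneg y
  have hw0 := abs_nonneg w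
  have hu : 0 ≤ 1 - t := by linarith
  have ht : 0 ≤ 1 - t ^ 2 := by nlinarith
  have h1 : |t ^ 2 * y + t * w - (y + w)| ≤ (1 - t ^ 2) * (|y| + |w|) := by
    have : t ^ 2 * y + t * w - (y + w) = -((1 - t ^ 2) * y + (1 - t) * w) := by ring
    rw [this, abs_neg]
    refine (abs_add_le _ _).trans ?_
    rw [abs_mul, abs_mul, abs_of_nonneg ht, abs_of_nonneg hu]
    linarith [mul_nonneg (mul_nonneg ht0 hu) hw0]
  have h2 : |t ^ 2 * y + t * w + (y + w)| ≤ 2 * (|y| + |w|) := by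
    have : t ^ 2 * y + t * w + (y + w) = (1 + t ^ 2) * y + (1 + t) * w := by ring
    rw [this]
    refine (abs_add_le _ _).trans ?_
    rw [abs_mul, abs_mul, abs_of_nonneg (by positivity : 0 ≤ 1 + t ^ 2),
      abs_of_nonneg (by positivity : 0 ≤ 1 + t)]
    linarith [mul_nonneg ht hy0, mul_nonneg hu hw0]
  have h3 : (|y| + |w|) ^ 2 ≤ 2 * (y ^ 2 + w ^ 2) := by
    linarith [sq_nonneg (|y| - |w|), sq_abs y, sq_abs w]
  calc |(t ^ 2 * y + t * w) ^ 2 - (y + w) ^ 2|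
      = |t ^ 2 * y + t * w - (y + w)| * |t ^ 2 * y + t * w + (y + w)| := by
        rw [← abs_mul]; congr 1; ring
    _ ≤ (1 - t ^ 2) * (|y| + |w|) * (2 * (|y| + |w|)) :=
        mul_le_mul h1 h2 (abs_nonneg _) (mul_nonneg ht (by positivity))
    _ = 2 * (1 - t ^ 2) * (|y| + |w|) ^ 2 := by ring
    _ ≤ 2 * (1 - t ^ 2) * (2 * (y ^ 2 + w ^ 2)) := by gcongr
    _ = _ := by ring

/-- The posterior `N(n y v, v)`, `v = (n + s⁻²)⁻¹`, is coupled linearly with its standardisation. -/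
lemma coordCoupling_gaussDens {s : ℝ} (hs : 0 < s) {n : ℕ} (hn : 0 < n) (y : ℝ) :
    CoordCoupling gaussDens s n y (4 * ((s ^ 2)⁻¹ / n) * (y ^ 2 + 1 / n)) := by
  have hn' : (0 : ℝ) < n := Nat.cast_pos.mpr hn
  have hsn : 0 < √(n : ℝ) := Real.sqrt_pos.mpr hn'
  have hi : (0 : ℝ) < (s ^ 2)⁻¹ := by positivity
  obtain ⟨v, hv⟩ : ∃ v : ℝ≥0, (v : ℝ) = (n + (s ^ 2)⁻¹)⁻¹ :=
    ⟨.mk _ (inv_nonneg.mpr (by positivity)), rfl⟩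
  obtain ⟨c, hc0, hc, hP⟩ := coordLaw_gaussDens_tilt hs hn y hv
  have hv0 : (0 : ℝ) ≤ v := v.2
  -- `t ^ 2 = n v` is the shrinkage factor of the posterior mean
  set t : ℝ := √n * √v with ht
  have ht0 : 0 ≤ t := by positivity
  have ht2 : t ^ 2 = n * v := by rw [ht, mul_pow, Real.sq_sqrt hn'.le, Real.sq_sqrt hv0]
  have hvi : (n + (s ^ 2)⁻¹) * (v : ℝ) = 1 := by rw [hv]; exact mul_inv_cancel₀ (by positivity)
  have hvn : (v : ℝ) ≤ 1 / n := by rw [le_div_iff₀ hn']; nlinarith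
  have hq : 1 - t ^ 2 ≤ (s ^ 2)⁻¹ / n := by
    have h1 : 1 - t ^ 2 = (s ^ 2)⁻¹ * v := by rw [ht2]; linarith
    rw [h1, div_eq_mul_one_div]
    exact mul_le_mul_of_nonneg_left hvn hi.le
  have ht1 : t ≤ 1 := by nlinarith [mul_nonneg hi.le hv0]
  have hvt : √(v : ℝ) = t / √n := by rw [ht]; field_simp
  have hm : Measurable fun ξ : ℝ => (n * y * v + √v * ξ, ξ) := by fun_prop
  have hid : MemLp (fun x : ℝ => x) 2 (gaussianReal 0 1) := memLp_id_gaussian (by simp)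
  have hint : Integrable (fun ξ => (n * y * v + √v * ξ) ^ 2 - (y + ξ / √n) ^ 2)
      (gaussianReal 0 1) := by
    refine Integrable.sub ?_ ?_
    · exact ((memLp_const (n * y * v)).add (hid.const_mul √v)).integrable_sq
    · have h := ((memLp_const y).add (hid.const_mul (√(n : ℝ))⁻¹)).integrable_sq
      refine h.congr (ae_of_all _ fun ξ => ?_)
      simp only [Pi.add_apply]
      rw [div_eq_inv_mul]
  have hpt : ∀ ξ : ℝ, |(n * y * v + √v * ξ) ^ 2 - (y + ξ / √n) ^ 2| ≤
      4 * ((s ^ 2)⁻¹ / n) * (y ^ 2 + 1 / n * ξ ^ 2) := fun ξ => by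
    set w := ξ / √(n : ℝ) with hw
    have hw2 : 1 / n * ξ ^ 2 = w ^ 2 := by rw [hw, div_pow, Real.sq_sqrt hn'.le]; ring
    have hx : n * y * v + √v * ξ = t ^ 2 * y + t * w := by rw [ht2, hvt, hw]; ring
    rw [hw2, hx]
    calc |(t ^ 2 * y + t * w) ^ 2 - (y + w) ^ 2| ≤ 4 * (1 - t ^ 2) * (y ^ 2 + w ^ 2) :=
          abs_sq_shrink_sub_sq_le ht0 ht1 y w
      _ ≤ _ := by gcongr
  have hbi : Integrable (fun ξ : ℝ => 4 * ((s ^ 2)⁻¹ / n) * (y ^ 2 + 1 / n * ξ ^ 2))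
      (gaussianReal 0 1) :=
    ((integrable_const _).add ((integrable_sq_gaussian 0 1).const_mul _)).const_mul _
  refine ⟨(gaussianReal 0 1).map fun ξ => (n * y * v + √v * ξ, ξ), c,
    Measure.isProbabilityMeasure_map hm.aemeasurable, hc0, hc, ?_, ?_, ?_, ?_⟩
  · rw [hP, Measure.map_map (by fun_prop) hm]
    have h1 : (Prod.fst ∘ fun ξ : ℝ => (n * y * v + √v * ξ, ξ)) =
        (fun x => n * y * v + x) ∘ fun ξ => √v * ξ := rfl
    rw [h1, ← Measure.map_map (by fun_prop) (by fun_prop), gaussianReal_map_const_mul,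
      gaussianReal_map_const_add]
    congr 2
    · ring
    · apply NNReal.coe_injective
      simp [Real.sq_sqrt hv0]
  · rw [Measure.map_map (by fun_prop) hm]
    exact Measure.map_id
  · rw [integrable_map_measure (by fun_prop) hm.aemeasurable]
    exact hint
  · rw [integral_map hm.aemeasurable (by fun_prop)]
    refine (integral_mono hint.abs hbi hpt).trans (le_of_eq ?_)
    rw [integral_const_mul, integral_add (integrable_const _)
      ((integrable_sq_gaussian 0 1).const_mul _), integral_const_mul, integral_sq_gaussian]
    simp

/-- Since the scales do not depend on `n`, a lower bound `1 / √n` on the first `K_n` of them is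
a polynomial lower bound on all of them. -/
lemma exists_inv_sq_scale_le {σ : ℕ → ℝ}
    (h : ∀ᶠ n : ℕ in atTop, ∀ k < truncLevel n, 1 / √(n : ℝ) ≤ σ k) {ε : ℝ} (hε : 0 < ε) :
    ∃ C : ℝ, 0 ≤ C ∧ ∀ k : ℕ, (σ k ^ 2)⁻¹ ≤ C * ((k : ℝ) + 1) ^ (1 + ε) := by
  -- with `n = ⌈(k + 1) ^ (1 + ε)⌉` the index `k` lies below the truncation level `n / log n`
  have hN : Tendsto (fun k : ℕ => ⌈((k : ℝ) + 1) ^ (1 + ε)⌉₊) atTop atTop := by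
    refine tendsto_nat_ceil_atTop.comp ((tendsto_rpow_atTop (by linarith)).comp ?_)
    exact tendsto_atTop_add_const_right _ _ tendsto_natCast_atTop_atTop
  have hlog : ∀ᶠ n : ℕ in atTop, Real.log n ≤ (n : ℝ) ^ (ε / (1 + ε)) := by
    have h1 := (isLittleO_log_rpow_atTop (r := ε / (1 + ε)) (by positivity)).bound one_pos
    filter_upwards [tendsto_natCast_atTop_atTop.eventually h1] with n hn
    rw [one_mul, Real.norm_of_nonneg (Real.rpow_nonneg (Nat.cast_nonneg _) _)] at hn
    exact (Real.le_norm_self _).trans hn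
  have hev : ∀ᶠ k : ℕ in atTop, (σ k ^ 2)⁻¹ ≤ 2 * ((k : ℝ) + 1) ^ (1 + ε) := by
    filter_upwards [hN.eventually h, hN.eventually hlog, hN.eventually_gt_atTop 1]
      with k hk hl h1
    set x : ℝ := (k : ℝ) + 1 with hx
    have hx1 : 1 ≤ x := by rw [hx]; linarith [Nat.cast_nonneg (α := ℝ) k]
    set n := ⌈x ^ (1 + ε)⌉₊ with hn
    have hn1 : (1 : ℝ) < n := by exact_mod_cast h1
    have hn0 : (0 : ℝ) < n := by linarith
    have hxn : x ^ (1 + ε) ≤ n := Nat.le_ceil _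
    have hnx : (n : ℝ) ≤ 2 * x ^ (1 + ε) := by
      have := (Nat.ceil_lt_add_one (by positivity : 0 ≤ x ^ (1 + ε))).le
      have := Real.one_le_rpow hx1 (by linarith : 0 ≤ 1 + ε)
      linarith
    have hlog0 : 0 < Real.log n := Real.log_pos hn1
    have hkn : k < truncLevel n := by
      refine Nat.lt_of_succ_le (Nat.le_floor ?_)
      push_cast
      rw [← hx, le_div_iff₀ hlog0]
      have hxr : x ≤ (n : ℝ) ^ (1 / (1 + ε)) := by
        have := Real.rpow_le_rpow (by positivity) hxn (by positivity : 0 ≤ 1 / (1 + ε))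
        rwa [← Real.rpow_mul (by linarith), mul_one_div_cancel (by linarith),
          Real.rpow_one] at this
      calc x * Real.log n ≤ (n : ℝ) ^ (1 / (1 + ε)) * (n : ℝ) ^ (ε / (1 + ε)) := by gcongr
        _ = n := by
          rw [← Real.rpow_add hn0, ← add_div, div_self (by linarith), Real.rpow_one]
    have hσ := hk k hkn
    refine le_trans ?_ hnx
    have hsn : 0 < √(n : ℝ) := Real.sqrt_pos.mpr hn0
    rw [inv_le_comm₀ (by have := (one_div_pos.mpr hsn).trans_le hσ; positivity) hn0]
    calc (n : ℝ)⁻¹ = (1 / √(n : ℝ)) ^ 2 := by rw [div_pow, Real.sq_sqrt hn0.le]; simp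
      _ ≤ σ k ^ 2 := by gcongr
  obtain ⟨k₀, hk₀⟩ := eventually_atTop.mp hev
  have hS : 0 ≤ ∑ k ∈ Finset.range k₀, (σ k ^ 2)⁻¹ := Finset.sum_nonneg fun _ _ => by positivity
  refine ⟨2 + ∑ k ∈ Finset.range k₀, (σ k ^ 2)⁻¹, by linarith, fun k => ?_⟩
  have hone : 1 ≤ ((k : ℝ) + 1) ^ (1 + ε) :=
    Real.one_le_rpow (by linarith [Nat.cast_nonneg (α := ℝ) k]) (by linarith)
  rcases lt_or_ge k k₀ with hk | hk
  · have h1 : (σ k ^ 2)⁻¹ ≤ ∑ k ∈ Finset.range k₀, (σ k ^ 2)⁻¹ :=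
      Finset.single_le_sum (f := fun k => (σ k ^ 2)⁻¹) (fun _ _ => by positivity)
        (Finset.mem_range.mpr hk)
    nlinarith
  · nlinarith [hk₀ k hk]

/-- The bias of the shrunken posterior means is negligible on a Sobolev class of order above
`1 / 4`: each term vanishes, and they are dominated by `k ^ (2 β) f_k ^ 2`. -/
lemma tendsto_weighted_coef_sum (φ : HilbertBasis ℕ ℝ L2) {β : ℝ} (hβ : 1 / 4 < β) {f : L2}
    (hf : f ∈ Sobolev φ β) {σ : ℕ → ℝ}
    (h : ∀ᶠ n : ℕ in atTop, ∀ k < truncLevel n, 1 / √(n : ℝ) ≤ σ k) :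
    Tendsto (fun n : ℕ => ∑ k ∈ Finset.range (truncLevel n),
      1 / √(n : ℝ) * ((σ k ^ 2)⁻¹ * coef φ f k ^ 2)) atTop (𝓝 0) := by
  obtain ⟨C, hC0, hC⟩ := exists_inv_sq_scale_le h (by linarith : 0 < 2 * β - 1 / 2)
  have hs : Tendsto (fun n : ℕ => 1 / √(n : ℝ)) atTop (𝓝 0) := by
    simp_rw [one_div]
    exact (Real.tendsto_sqrt_atTop.comp tendsto_natCast_atTop_atTop).inv_tendsto_atTop
  have key := tendsto_tsum_of_dominated_convergence (𝓕 := atTop)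
    (f := fun (n : ℕ) (k : ℕ) => if k < truncLevel n then
      1 / √(n : ℝ) * ((σ k ^ 2)⁻¹ * coef φ f k ^ 2) else 0) (g := fun _ => (0 : ℝ))
    (bound := fun k => C * (((k : ℝ) + 1) ^ (2 * β) * coef φ f k ^ 2))
    (Summable.mul_left C hf) (fun k => ?_) ?_
  · rw [tsum_zero] at key
    refine key.congr fun n => ?_
    rw [tsum_eq_sum (s := Finset.range (truncLevel n)) fun k hk => if_neg (by simpa using hk)]
    exact Finset.sum_congr rfl fun k hk => if_pos (by simpa using hk)
  · have h1 := hs.mul_const ((σ k ^ 2)⁻¹ * coef φ f k ^ 2)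
    rw [zero_mul] at h1
    refine h1.congr' ?_
    filter_upwards [tendsto_truncLevel.eventually_gt_atTop k] with n hn
    rw [if_pos hn]
  · filter_upwards [eventually_ge_atTop 3] with n hn k
    have hk0 : (0 : ℝ) < (k : ℝ) + 1 := by positivity
    split_ifs with hk
    · have hkn : ((k : ℝ) + 1) ≤ n := by
        exact_mod_cast (Nat.succ_le_of_lt hk).trans (truncLevel_le hn)
      rw [Real.norm_of_nonneg (by positivity)]
      have h1 : 1 / √(n : ℝ) ≤ ((k : ℝ) + 1) ^ (-(1 / 2) : ℝ) := by
        rw [Real.rpow_neg hk0.le, ← Real.sqrt_eq_rpow, one_div]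
        exact inv_anti₀ (Real.sqrt_pos.mpr hk0) (Real.sqrt_le_sqrt hkn)
      calc 1 / √(n : ℝ) * ((σ k ^ 2)⁻¹ * coef φ f k ^ 2)
          ≤ ((k : ℝ) + 1) ^ (-(1 / 2) : ℝ) *
            (C * ((k : ℝ) + 1) ^ (1 + (2 * β - 1 / 2)) * coef φ f k ^ 2) := by
            gcongr
            exact hC k
        _ = C * (((k : ℝ) + 1) ^ (-(1 / 2) + (1 + (2 * β - 1 / 2))) * coef φ f k ^ 2) := by
            generalize 1 + (2 * β - 1 / 2) = e
            rw [Real.rpow_add hk0]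
            ring
        _ = _ := by
            congr 3
            ring
    · rw [norm_zero]
      positivity

theorem bvM_gaussDens (φ : HilbertBasis ℕ ℝ L2) {β : ℝ} (hβ : 1 / 4 < β) {f₀ : L2}
    (hf₀ : f₀ ∈ Sobolev φ β) {σ : ℕ → ℝ} (hσ : ∀ k, 0 < σ k)
    (hlow : ∀ᶠ n : ℕ in atTop, ∀ k < truncLevel n, 1 / √(n : ℝ) ≤ σ k)
    (hsum : Tendsto (fun n : ℕ => 1 / √(n : ℝ) *
      ∑ k ∈ Finset.range (truncLevel n), (σ k ^ 2)⁻¹ / (n : ℝ)) atTop (𝓝 0)) :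
    BvM φ gaussDens σ f₀ := by
  refine bvM_of_coordCoupling φ gaussDens σ f₀
    (fun k => isProbabilityMeasure_coordLaw_gaussDens (hσ k))
    (fun n k y => 4 * ((σ k ^ 2)⁻¹ / n) * (y ^ 2 + 1 / n))
    (fun n k => 4 * ((σ k ^ 2)⁻¹ / n) * (coef φ f₀ k ^ 2 + 2 / n)) ?_ ?_
  · filter_upwards [eventually_gt_atTop 0] with n hn k _
    have hi := integrable_sq_gaussian (coef φ f₀ k) (1 / (n : ℝ≥0))
    refine ⟨fun y => coordCoupling_gaussDens (hσ k) hn y,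
      (hi.add (integrable_const _)).const_mul _, le_of_eq ?_⟩
    rw [integral_const_mul, integral_add hi (integrable_const _), integral_sq_gaussian]
    simp only [integral_const, probReal_univ, smul_eq_mul, one_mul]
    push_cast
    ring
  · have h := ((tendsto_weighted_coef_sum φ hβ hf₀ hlow).const_mul 4).add (hsum.const_mul 8)
    simp only [mul_zero, add_zero] at h
    refine h.congr' ?_
    filter_upwards [eventually_gt_atTop 0] with n hn
    have hn' : (0 : ℝ) < n := Nat.cast_pos.mpr hn
    have hs : √(n : ℝ) / n = 1 / √(n : ℝ) := Real.sqrt_div_self'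
    simp only [Finset.mul_sum, ← Finset.sum_add_distrib]
    refine Finset.sum_congr rfl fun k _ => ?_
    rw [← hs]
    ring

/-! ### Uniform prior -/

lemma unifDens_div {R s : ℝ} (hs : 0 < s) (x : ℝ) :
    1 / s * unifDens R (x / s) =
      (Set.Icc (-(R * s)) (R * s)).indicator (fun _ => 1 / (2 * (R * s))) x := by
  have h : x / s ∈ Set.Icc (-R) R ↔ x ∈ Set.Icc (-(R * s)) (R * s) := by
    rw [Set.mem_Icc, Set.mem_Icc, le_div_iff₀ hs, div_le_iff₀ hs, neg_mul]
  by_cases hx : x ∈ Set.Icc (-(R * s)) (R * s)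
  · rw [unifDens, Set.indicator_of_mem (h.mpr hx), Set.indicator_of_mem hx]
    field_simp
  · rw [unifDens, Set.indicator_of_notMem (mt h.mp hx), Set.indicator_of_notMem hx, mul_zero]

lemma isProbabilityMeasure_coordLaw_unifDens {R s : ℝ} (hR : 0 < R) (hs : 0 < s) :
    IsProbabilityMeasure (coordLaw (unifDens R) s) := by
  have ha : 0 < R * s := mul_pos hR hs
  refine ⟨?_⟩
  simp_rw [coordLaw, unifDens_div hs]
  have h : (fun x => ENNReal.ofReal
      ((Set.Icc (-(R * s)) (R * s)).indicator (fun _ => 1 / (2 * (R * s))) x)) =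
      (Set.Icc (-(R * s)) (R * s)).indicator fun _ => ENNReal.ofReal (1 / (2 * (R * s))) := by
    funext x
    by_cases hx : x ∈ Set.Icc (-(R * s)) (R * s) <;> simp [hx]
  rw [h, withDensity_indicator measurableSet_Icc, withDensity_const]
  simp only [Measure.smul_apply, Measure.restrict_apply_univ, Real.volume_Icc, smul_eq_mul]
  rw [← ENNReal.ofReal_mul (by positivity)]
  have : 1 / (2 * (R * s)) * (R * s - -(R * s)) = 1 := by field_simp; ring
  rw [this, ENNReal.ofReal_one]

lemma gaussian_Icc_ne_zero {a y : ℝ} {v : ℝ≥0} (ha : 0 < a) (hv : v ≠ 0) :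
    gaussianReal y v (Set.Icc (-a) a) ≠ 0 := fun h => by
  have := gaussianReal_absolutelyContinuous' y hv h
  rw [Real.volume_Icc, ENNReal.ofReal_eq_zero] at this
  linarith

/-- For a uniform prior the posterior of a coordinate is the law `N(y, 1 / n)` conditioned on the
support of the prior. -/
lemma coordLaw_unifDens_tilt {R s : ℝ} (hR : 0 < R) (hs : 0 < s) {n : ℕ} (hn : 0 < n) (y : ℝ) :
    ∃ c : ℝ≥0∞, c ≠ 0 ∧ c ≠ ∞ ∧ (coordLaw (unifDens R) s).withDensity (coordLik n y) =
      c • (gaussianReal y (1 / (n : ℝ≥0)))[|Set.Icc (-(R * s)) (R * s)] := by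
  have hn' : (0 : ℝ) < n := Nat.cast_pos.mpr hn
  have ha : 0 < R * s := mul_pos hR hs
  have hv : (1 / (n : ℝ≥0)) ≠ 0 := by positivity
  set I := Set.Icc (-(R * s)) (R * s) with hI
  have hIm : MeasurableSet I := measurableSet_Icc
  set g := gaussianPDFReal y (1 / (n : ℝ≥0)) with hg
  have hgm : Measurable g := measurable_gaussianPDFReal _ _
  set C : ℝ := 1 / (2 * (R * s)) * √(2 * Real.pi * (1 / n)) * Real.exp (n * y ^ 2 / 2) with hC
  have hC0 : 0 < C := by positivity
  have h0 := gaussian_Icc_ne_zero (y := y) ha hv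
  refine ⟨ENNReal.ofReal C * gaussianReal y (1 / (n : ℝ≥0)) I,
    mul_ne_zero (by simpa using hC0) h0, by finiteness, ?_⟩
  have hcond : gaussianReal y (1 / (n : ℝ≥0)) I • (gaussianReal y (1 / (n : ℝ≥0)))[|I] =
      volume.withDensity fun x => ENNReal.ofReal (I.indicator g x) := by
    rw [ProbabilityTheory.cond, smul_smul, ENNReal.mul_inv_cancel h0 (by finiteness), one_smul,
      gaussianReal_of_var_ne_zero _ hv, restrict_withDensity hIm, ← withDensity_indicator hIm]
    congr 1
    funext x
    by_cases hx : x ∈ I <;> simp [hx, gaussianPDF, hg]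
  rw [mul_smul, hcond, coordLaw]
  simp_rw [unifDens_div hs]
  refine withDensity_ofReal_mul _ _ _ C (measurable_const.indicator hIm) (by fun_prop)
    (hgm.indicator hIm) (fun x => Set.indicator_nonneg (fun _ _ => by positivity) _) hC0.le
    fun x => ?_
  by_cases hx : x ∈ I
  · rw [Set.indicator_of_mem hx, Set.indicator_of_mem hx, hg]
    simp only [gaussianPDFReal, hC, NNReal.coe_div, NNReal.coe_one, NNReal.coe_natCast]
    have h2 : √(2 * Real.pi * (1 / n)) ≠ 0 := by positivity
    have hexp : Real.exp (n * (x * y) - n * x ^ 2 / 2) =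
        Real.exp (n * y ^ 2 / 2) * Real.exp (-(x - y) ^ 2 / (2 * (1 / n))) := by
      rw [← Real.exp_add]
      congr 1
      field_simp
      ring
    rw [hexp]
    generalize √(2 * Real.pi * (1 / n)) = b at h2
    field_simp
  · rw [Set.indicator_of_notMem hx, Set.indicator_of_notMem hx, zero_mul, mul_zero]

/-- Rejection sampling: replacing a draw outside `I` by an independent draw from the conditional
law yields the conditional law. -/
lemma map_ite_prod_cond {γ : Measure ℝ} [IsProbabilityMeasure γ] {I : Set ℝ} [DecidablePred (· ∈ I)]
    (hI : MeasurableSet I) (h0 : γ I ≠ 0) :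
    (γ.prod γ[|I]).map (fun p => if p.1 ∈ I then p.1 else p.2) = γ[|I] := by
  have : IsProbabilityMeasure γ[|I] := cond_isProbabilityMeasure h0
  have hm : Measurable fun p : ℝ × ℝ => if p.1 ∈ I then p.1 else p.2 :=
    Measurable.ite (measurable_fst hI) measurable_fst measurable_snd
  ext A hA
  rw [Measure.map_apply hm hA]
  have hpre : (fun p : ℝ × ℝ => if p.1 ∈ I then p.1 else p.2) ⁻¹' A =
      (I ∩ A) ×ˢ Set.univ ∪ Iᶜ ×ˢ A := by
    ext p
    by_cases hp : p.1 ∈ I <;> simp [hp]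
  have hdisj : Disjoint ((I ∩ A) ×ˢ (Set.univ : Set ℝ)) (Iᶜ ×ˢ A) := by
    rw [Set.disjoint_left]
    rintro p ⟨⟨h1, -⟩, -⟩ ⟨h2, -⟩
    exact h2 h1
  rw [hpre, measure_union hdisj (hI.compl.prod hA), Measure.prod_prod, Measure.prod_prod,
    measure_univ, mul_one, cond_apply hI, prob_compl_eq_one_sub hI, ← mul_assoc,
    ENNReal.sub_mul (fun _ _ => ENNReal.inv_ne_top.mpr h0), one_mul,
    ENNReal.mul_inv_cancel h0 (by finiteness), ENNReal.sub_mul (fun _ _ => by finiteness), one_mul]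
  refine add_tsub_cancel_of_le ?_
  calc γ (I ∩ A) ≤ (γ I)⁻¹ * γ (I ∩ A) :=
    le_mul_of_one_le_left zero_le (ENNReal.one_le_inv.mpr prob_le_one)

lemma integral_exp_mul_gaussian (m : ℝ) (v : ℝ≥0) (t : ℝ) :
    ∫ x, Real.exp (t * x) ∂gaussianReal m v = Real.exp (m * t + v * t ^ 2 / 2) :=
  mgf_gaussianReal (X := id) (by simp) t

/-- Exponential bound on the part of the second moment outside `[-a, a]`, with tilt
`t = n a / 4 + √n`: `n a / 4` produces the decay and `√n` absorbs the square. -/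
lemma sq_le_exp_of_lt_abs {n a z : ℝ} (hn : 0 < n) (ha : 0 < a) (hz : a < |z|) :
    z ^ 2 ≤ 2 / n * Real.exp (-(n * a / 4 * a)) *
      (Real.exp ((n * a / 4 + √n) * z) + Real.exp (-(n * a / 4 + √n) * z)) := by
  have hsn : √n ^ 2 = n := Real.sq_sqrt hn.le
  have h1 : z ^ 2 ≤ 2 / n * Real.exp (√n * |z|) := by
    have h := Real.quadratic_le_exp_of_nonneg (by positivity : 0 ≤ √n * |z|)
    rw [mul_pow, hsn, sq_abs] at h
    have h' : n * z ^ 2 / 2 ≤ Real.exp (√n * |z|) := by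
      linarith [(by positivity : 0 ≤ √n * |z|)]
    calc z ^ 2 = 2 / n * (n * z ^ 2 / 2) := by field_simp
      _ ≤ _ := by gcongr
  have h2 : Real.exp (√n * |z|) ≤
      Real.exp (-(n * a / 4 * a)) * Real.exp ((n * a / 4 + √n) * |z|) := by
    rw [← Real.exp_add, Real.exp_le_exp]
    nlinarith [mul_pos hn ha]
  have h3 : Real.exp ((n * a / 4 + √n) * |z|) ≤
      Real.exp ((n * a / 4 + √n) * z) + Real.exp (-(n * a / 4 + √n) * z) := by
    rcases abs_cases z with ⟨h, -⟩ | ⟨h, -⟩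
    · rw [h]; linarith [Real.exp_pos (-(n * a / 4 + √n) * z)]
    · rw [h, mul_neg, ← neg_mul]; linarith [Real.exp_pos ((n * a / 4 + √n) * z)]
  calc z ^ 2 ≤ 2 / n * (Real.exp (-(n * a / 4 * a)) * (Real.exp ((n * a / 4 + √n) * z) +
        Real.exp (-(n * a / 4 + √n) * z))) :=
        h1.trans (mul_le_mul_of_nonneg_left (h2.trans (by gcongr)) (by positivity))
    _ = _ := by ring

/-- The coupling error of a coordinate under a uniform prior with support `[-a, a]`, given the
observation `y`. -/
noncomputable def unifError (n : ℕ) (a y : ℝ) : ℝ :=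
  2 / n * Real.exp (-(n * a / 4 * a)) * Real.exp ((n * a / 4 + √n) ^ 2 / (2 * n)) *
    (Real.exp ((n * a / 4 + √n) * y) + Real.exp (-(n * a / 4 + √n) * y))

lemma coordCoupling_unifDens {R s : ℝ} (hR : 0 < R) (hs : 0 < s) {n : ℕ} (hn : 0 < n) (y : ℝ) :
    CoordCoupling (unifDens R) s n y (unifError n (R * s) y) := by
  classical
  have hn' : (0 : ℝ) < n := Nat.cast_pos.mpr hn
  have hsn : 0 < √(n : ℝ) := Real.sqrt_pos.mpr hn'
  have ha : 0 < R * s := mul_pos hR hs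
  have hv : (1 / (n : ℝ≥0)) ≠ 0 := by positivity
  obtain ⟨c, hc0, hc, hP⟩ := coordLaw_unifDens_tilt hR hs hn y
  set a := R * s with hadef
  set γ := gaussianReal y (1 / (n : ℝ≥0)) with hγ
  set I := Set.Icc (-a) a with hIdef
  have hI : MeasurableSet I := measurableSet_Icc
  have h0 : γ I ≠ 0 := gaussian_Icc_ne_zero ha hv
  have : IsProbabilityMeasure γ[|I] := cond_isProbabilityMeasure h0
  have hm1 : Measurable fun p : ℝ × ℝ => if p.1 ∈ I then p.1 else p.2 :=
    Measurable.ite (measurable_fst hI) measurable_fst measurable_snd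
  have hm : Measurable fun p : ℝ × ℝ => (if p.1 ∈ I then p.1 else p.2, √n * (p.1 - y)) :=
    hm1.prodMk (by fun_prop)
  set E : ℝ → ℝ := fun z => 2 / n * Real.exp (-(n * a / 4 * a)) *
      (Real.exp ((n * a / 4 + √n) * z) + Real.exp (-(n * a / 4 + √n) * z)) with hE
  have hei : ∀ t : ℝ, Integrable (fun z => Real.exp (t * z)) γ := fun t =>
    integrable_exp_mul_gaussianReal t
  have hEi : Integrable E γ := ((hei _).add (hei _)).const_mul _
  have hEi' : Integrable (fun p : ℝ × ℝ => E p.1) (γ.prod γ[|I]) := hEi.comp_fst _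
  have hEint : ∫ z, E z ∂γ = unifError n a y := by
    rw [integral_const_mul, integral_add (hei _) (hei _), hγ, integral_exp_mul_gaussian,
      integral_exp_mul_gaussian, unifError, mul_assoc _ (Real.exp ((n * a / 4 + √n) ^ 2 / _)),
      mul_add (Real.exp ((n * a / 4 + √n) ^ 2 / _)), ← Real.exp_add, ← Real.exp_add]
    simp only [NNReal.coe_div, NNReal.coe_one, NNReal.coe_natCast]
    congr 3
    · field_simp
      ring
    · field_simp
      ring
  have hz : ∀ z : ℝ, y + √n * (z - y) / √n = z := fun z => by field_simp; ring
  have hae : ∀ᵐ p ∂γ.prod γ[|I], p.2 ∈ I := by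
    have h1 : ∀ᵐ u ∂γ[|I], u ∈ I := ae_cond_mem hI
    exact Measure.quasiMeasurePreserving_snd.ae h1
  have hpt : ∀ᵐ p ∂γ.prod γ[|I],
      |(if p.1 ∈ I then p.1 else p.2) ^ 2 - (y + √n * (p.1 - y) / √n) ^ 2| ≤ E p.1 := by
    filter_upwards [hae] with p hp
    rw [hz]
    have hE0 : 0 ≤ E p.1 := by positivity
    split_ifs with h
    · simpa using hE0
    · have h1 : |p.2| ≤ a := abs_le.mpr hp
      have h2 : a < |p.1| := by
        by_contra hcon
        exact h (abs_le.mp (not_lt.mp hcon))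
      have h3 : p.2 ^ 2 ≤ p.1 ^ 2 := sq_le_sq.mpr (h1.trans h2.le)
      rw [abs_of_nonpos (by linarith)]
      have h4 := sq_le_exp_of_lt_abs hn' ha h2
      linarith [sq_nonneg p.2]
  have hmeas : Measurable fun p : ℝ × ℝ =>
      (if p.1 ∈ I then p.1 else p.2) ^ 2 - (y + √n * (p.1 - y) / √n) ^ 2 :=
    (hm1.pow_const 2).sub (by fun_prop)
  have hint : Integrable (fun p : ℝ × ℝ =>
      (if p.1 ∈ I then p.1 else p.2) ^ 2 - (y + √n * (p.1 - y) / √n) ^ 2) (γ.prod γ[|I]) :=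
    hEi'.mono' hmeas.aestronglyMeasurable hpt
  -- `p.1` is the unconditioned draw `y + ξ / √n`, and `p.2` its replacement outside `I`
  refine ⟨(γ.prod γ[|I]).map fun p => (if p.1 ∈ I then p.1 else p.2, √n * (p.1 - y)), c,
    Measure.isProbabilityMeasure_map hm.aemeasurable, hc0, hc, ?_, ?_, ?_, ?_⟩
  · rw [hP, Measure.map_map (by fun_prop) hm]
    exact congrArg _ (map_ite_prod_cond hI h0).symm
  · rw [Measure.map_map (by fun_prop) hm]
    have h1 : (Prod.snd ∘ fun p : ℝ × ℝ => (if p.1 ∈ I then p.1 else p.2, √n * (p.1 - y))) =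
        (fun x => √(n : ℝ) * x) ∘ (fun z => z - y) ∘ Prod.fst := rfl
    rw [h1, ← Measure.map_map (by fun_prop) (by fun_prop),
      ← Measure.map_map (by fun_prop) (by fun_prop), Measure.map_fst_prod, measure_univ, one_smul,
      hγ, gaussianReal_map_sub_const, gaussianReal_map_const_mul]
    congr 1
    · simp
    · apply NNReal.coe_injective
      simp only [NNReal.coe_mul, NNReal.coe_mk, NNReal.coe_div, NNReal.coe_one,
        NNReal.coe_natCast]
      rw [Real.sq_sqrt hn'.le]
      field_simp
  · rw [integrable_map_measure (by fun_prop) hm.aemeasurable]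
    exact hint
  · rw [integral_map hm.aemeasurable (by fun_prop), ← hEint]
    refine (integral_mono_ae hint.abs hEi' hpt).trans (le_of_eq ?_)
    rw [integral_fun_fst]
    simp

/-- Averaging over the observation, with the true coefficient well inside the support, gives a
coupling error that decays like a Gaussian tail in `√n a`. -/
lemma integral_unifError_le {n : ℕ} (hn : 0 < n) {a f : ℝ} (ha : 0 < a) (hf : |f| ≤ a / 16) :
    Integrable (unifError n a) (gaussianReal f (1 / (n : ℝ≥0))) ∧
      ∫ y, unifError n a y ∂gaussianReal f (1 / (n : ℝ≥0)) ≤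
        4 / n * Real.exp (3 - 3 / 32 * n * a ^ 2) := by
  have hn' : (0 : ℝ) < n := Nat.cast_pos.mpr hn
  have hei : ∀ t : ℝ, Integrable (fun z => Real.exp (t * z)) (gaussianReal f (1 / (n : ℝ≥0))) :=
    fun t => integrable_exp_mul_gaussianReal t
  refine ⟨((hei _).add (hei _)).const_mul _, ?_⟩
  have hb : ∀ t : ℝ, |t| = n * a / 4 + √n →
      Real.exp (-(n * a / 4 * a)) * Real.exp ((n * a / 4 + √n) ^ 2 / (2 * n)) *
        Real.exp (f * t + 1 / n * t ^ 2 / 2) ≤ Real.exp (3 - 3 / 32 * n * a ^ 2) := fun t ht => by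
    rw [← Real.exp_add, ← Real.exp_add, Real.exp_le_exp]
    have h1 : f * t ≤ a / 16 * (n * a / 4 + √n) := by
      rw [← ht]
      exact (le_abs_self _).trans (by rw [abs_mul]; gcongr)
    have h2 : t ^ 2 = (n * a / 4 + √n) ^ 2 := by rw [← ht, sq_abs]
    rw [h2]
    -- in terms of `A = √n a`
    set r := √(n : ℝ) with hr
    have hr0 : 0 < r := Real.sqrt_pos.mpr hn'
    have hrn : (n : ℝ) = r ^ 2 := (Real.sq_sqrt hn'.le).symm
    rw [hrn] at h1 ⊢
    have h3 : (r ^ 2 * a / 4 + r) ^ 2 / (2 * r ^ 2) = (r * a / 4 + 1) ^ 2 / 2 := by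
      field_simp
    have h4 : 1 / r ^ 2 * (r ^ 2 * a / 4 + r) ^ 2 / 2 = (r * a / 4 + 1) ^ 2 / 2 := by
      field_simp
    rw [h3, h4]
    nlinarith [sq_nonneg (r * a - 8)]
  set t := n * a / 4 + √(n : ℝ) with ht
  have ht0 : 0 ≤ t := by positivity
  have e : ∫ y, unifError n a y ∂gaussianReal f (1 / (n : ℝ≥0)) =
      2 / n * (Real.exp (-(n * a / 4 * a)) * Real.exp (t ^ 2 / (2 * n)) *
        Real.exp (f * t + 1 / n * t ^ 2 / 2) +
      Real.exp (-(n * a / 4 * a)) * Real.exp (t ^ 2 / (2 * n)) *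
        Real.exp (f * -t + 1 / n * (-t) ^ 2 / 2)) := by
    simp only [unifError, ← ht]
    rw [integral_const_mul, integral_add (hei _) (hei _), integral_exp_mul_gaussian,
      integral_exp_mul_gaussian]
    push_cast
    ring
  rw [e]
  have h1 := hb t (abs_of_nonneg ht0)
  have h2 := hb (-t) (by rw [abs_neg, abs_of_nonneg ht0])
  calc _ ≤ 2 / (n : ℝ) * (Real.exp (3 - 3 / 32 * n * a ^ 2) +
        Real.exp (3 - 3 / 32 * n * a ^ 2)) := by gcongr
    _ = _ := by ring

theorem bvM_unifDens (φ : HilbertBasis ℕ ℝ L2) (f₀ : L2) {σ : ℕ → ℝ} (hσ : ∀ k, 0 < σ k)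
    {M R : ℝ} (hR0 : 0 < R) (hR : 16 * M < R)
    (hcond : ∀ᶠ n : ℕ in atTop, ∀ k < truncLevel n,
      |coef φ f₀ k| / σ k ≤ M ∧ 1 / √(n : ℝ) ≤ σ k)
    (hsum : ∀ c : ℝ, 0 < c → Tendsto (fun n : ℕ =>
      ∑ k ∈ Finset.range (truncLevel n), σ k * Real.exp (-c * n * σ k ^ 2)) atTop (𝓝 0)) :
    BvM φ (unifDens R) σ f₀ := by
  refine bvM_of_coordCoupling φ (unifDens R) σ f₀
    (fun k => isProbabilityMeasure_coordLaw_unifDens hR0 (hσ k))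
    (fun n k => unifError n (R * σ k))
    (fun n k => 4 * Real.exp 3 * (1 / √(n : ℝ) *
      (σ k * Real.exp (-(3 / 32 * R ^ 2) * n * σ k ^ 2)))) ?_ ?_
  · filter_upwards [hcond, eventually_gt_atTop 0] with n hc hn k hk
    have hn' : (0 : ℝ) < n := Nat.cast_pos.mpr hn
    obtain ⟨h1, h2⟩ := hc k hk
    have hf : |coef φ f₀ k| ≤ R * σ k / 16 := by
      rw [div_le_iff₀ (hσ k)] at h1
      nlinarith [mul_lt_mul_of_pos_right hR (hσ k)]
    obtain ⟨hi, hle⟩ := integral_unifError_le hn (mul_pos hR0 (hσ k)) hf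
    refine ⟨fun y => coordCoupling_unifDens hR0 (hσ k) hn y, hi, hle.trans ?_⟩
    have h3 : 1 / (n : ℝ) = 1 / √(n : ℝ) * (1 / √(n : ℝ)) := by
      rw [one_div_mul_one_div, Real.mul_self_sqrt hn'.le]
    calc 4 / (n : ℝ) * Real.exp (3 - 3 / 32 * n * (R * σ k) ^ 2)
        = 4 * Real.exp 3 * (1 / √(n : ℝ) * (1 / √(n : ℝ) *
            Real.exp (-(3 / 32 * R ^ 2) * n * σ k ^ 2))) := by
          rw [← mul_assoc (1 / √(n : ℝ)), ← h3,
            show 3 - 3 / 32 * n * (R * σ k) ^ 2 = 3 + -(3 / 32 * R ^ 2) * n * σ k ^ 2 by ring,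
            Real.exp_add]
          ring
      _ ≤ _ := by gcongr
  · have h := (hsum (3 / 32 * R ^ 2) (by positivity)).const_mul (4 * Real.exp 3)
    rw [mul_zero] at h
    refine h.congr' ?_
    filter_upwards [eventually_gt_atTop 0] with n hn
    have hsn : 0 < √(n : ℝ) := Real.sqrt_pos.mpr (Nat.cast_pos.mpr hn)
    rw [← Finset.mul_sum, ← Finset.mul_sum, mul_left_comm, ← mul_assoc √(n : ℝ),
      mul_one_div_cancel hsn.ne', one_mul]

end WhiteNoise

theorem theorem3p1 (φ : HilbertBasis ℕ ℝ WhiteNoise.L2) (β : ℝ) (hβ : 1 / 4 < β)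
    (f₀ : WhiteNoise.L2) (hf₀ : f₀ ∈ WhiteNoise.Sobolev φ β)
    (σ : ℕ → ℝ) (hσ : ∀ k, 0 < σ k) (M : ℝ) (hM : 0 < M)
    (hcond : ∀ᶠ n : ℕ in atTop, ∀ k < WhiteNoise.truncLevel n,
      |WhiteNoise.coef φ f₀ k| / σ k ≤ M ∧ 1 / √(n : ℝ) ≤ σ k) :
    (Tendsto (fun n : ℕ => 1 / √(n : ℝ) *
        ∑ k ∈ Finset.range (WhiteNoise.truncLevel n), (σ k ^ 2)⁻¹ / (n : ℝ)) atTop (𝓝 0) →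
      WhiteNoise.BvM φ WhiteNoise.gaussDens σ f₀) ∧
    (∀ R : ℝ, max 4 (16 * M) < R →
      (∀ c : ℝ, 0 < c → Tendsto (fun n : ℕ =>
        ∑ k ∈ Finset.range (WhiteNoise.truncLevel n), σ k * Real.exp (-c * n * σ k ^ 2))
          atTop (𝓝 0)) →
      WhiteNoise.BvM φ (WhiteNoise.unifDens R) σ f₀) := by
  refine ⟨fun h => WhiteNoise.bvM_gaussDens φ hβ hf₀ hσ
    (hcond.mono fun n hn k hk => (hn k hk).2) h, fun R hR h => ?_⟩
  exact WhiteNoise.bvM_unifDens φ f₀ hσ (by linarith [le_max_left 4 (16 * M)])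
    ((le_max_right _ _).trans_lt hR) hcond h
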